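/- **Conventions.** On $\mathbb R\cup\{\pm\infty\}$ use the rule $\infty-\infty=+\infty$. For probability measures $\mu,\nu$ on $X,Y$, measurable $c:X\times Y\to\mathbb R$ and $\varepsilon>0$, put $$\mathrm{OT}^\varepsilon_c(\mu,\nu)=\inf_{\pi\in\Pi(\mu,\nu)}\int c\,d\pi+\varepsilon\,\mathrm{KL}(\pi|\mu\otimes\nu),\qquad \int c\,d\pi:=\int c^+d\pi-\int c^-d\pi ,$$ where $\Pi(\mu,\nu)$ is the set of couplings and $\mathrm{KL}$ the relative entropy. A function $C:S\times S\to\mathbb R\cup\{+\infty\}$ is *debiasable* if it is symmetric and $C(x,y)-\tfrac12C(x,x)-\tfrac12C(y,y)\ge0$ for all $x,y\in S$. A function $c:\mathbb X\times\mathbb X\to\mathbb R$ is *negative definite* if it is symmetric and $\sum_{i,j}a_ia_jc(x_i,x_j)\le0$ for all finite families $x_i\in\mathbb X$, $a_i\in\mathbb R$ with $\sum_ia_i=0$. **Theorem.** Let $\mathbb X$ be a Polish space, $c:\mathbb X\times\mathbb X\to\mathbb R$ continuous and negative definite, $\varepsilon>0$. Let $\lambda=\bigotimes_{i\in\mathbb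 N}\mathcal N(0,1)$ on $\mathcal Z=\mathbb R^{\mathbb N}$, let $s(x)=c(x,x)/2$, and let $\mathcal P_c(\mathbb X)$ be the set of Borel probability measures $\mu$ on $\mathbb X$ with $\int s^-\,d\mu<\infty$ (all of $\mathcal P(\mathbb X)$ if $c$ is bounded below). 1. There are a continuous map $\phi:\mathbb X\to\ell^2(\mathbb N)$ with $c(x,y)=|\phi(x)-\phi(y)|^2+s(x)+s(y)$ for all $x,y$, and a jointly measurable $\rho_\varepsilon:\mathbb X\times\mathcal Z\to(0,\infty)$ such that for every $x$ and $\lambda$-a.e. $z$ the series $\sum_i\phi_i(x)z_i$ (limit of partial sums) converges and $$\rho_\varepsilon(x,z)=\exp\Big(\sqrt{\tfrac2\varepsilon}\sum_{i}\phi_i(x)z_i-\tfrac2\varepsilon|\phi(x)|^2-\tfrac{s(x)}\varepsilon\Big),$$ with $\rho_\varepsilon(x,\cdot)\in L^2(\lambda)$ for every $x$ and, for all $x,y\in\mathbb X$, $$e^{-c(x,y)/\varepsilon}=\int_{\mathcal Z}\rho_\varepsilon(x,z)\rho_\varepsilon(y,z)\,d\lambda(z).$$ Thus the kernel $e^{-c/\varepsilon}$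 is completely positive. With $\tilde\psi=-\varepsilon\log\rho_\varepsilon$ one has $c(x,y)=-\varepsilon\log\int_{\mathcal Z}e^{-(\tilde\psi(x,z)+\tilde\psi(y,z))/\varepsilon}d\lambda(z)$ for all $x,y$. Moreover, for all $\mu,\nu\in\mathcal P_c(\mathbb X)$, $$\mathrm{OT}^\varepsilon_c(\mu,\nu)\le\inf_{\eta\in\mathcal P(\mathcal Z)}\mathrm{OT}^\varepsilon_{\tilde\psi}(\mu,\eta)+\mathrm{OT}^\varepsilon_{\tilde\psi}(\nu,\eta)+\varepsilon\,\mathrm{KL}(\eta|\lambda),$$ with equality whenever $c\in L^1(\mu\otimes\nu)$. 2. $\mathrm{OT}^\varepsilon_c$ is debiasable on $\mathcal P_c(\mathbb X)$; in particular it takes values in $\mathbb R\cup\{+\infty\}$ there. -/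

import Mathlib

open MeasureTheory ProbabilityTheory Filter Topology
open scoped ENNReal

noncomputable section

/-- Addition of extended reals with the rule `∞ - ∞ = +∞`
(Mathlib's addition on `EReal` uses the opposite rule `⊤ + ⊥ = ⊥`). -/
def upperAdd (a b : EReal) : EReal := -(-a + -b)

theorem upperAdd_top (a : EReal) : upperAdd a ⊤ = ⊤ := by
  simp [upperAdd]

theorem top_upperAdd (a : EReal) : upperAdd ⊤ a = ⊤ := by
  simp [upperAdd]

theorem upperAdd_coe (a b : ℝ) : upperAdd (a : EReal) (b : EReal) = ((a + b : ℝ) : EReal) := by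
  unfold upperAdd
  norm_cast
  ring_nf

/-- The debiased cost `C x y - C x x / 2 - C y y / 2`, with the rule `∞ - ∞ = +∞`. -/
def debiasedCost {S : Type*} (C : S → S → EReal) (x y : S) : EReal :=
  upperAdd (upperAdd (C x y) (-(C x x / 2))) (-(C y y / 2))

/-- A symmetric cost `C : S × S → ℝ ∪ {+∞}` is debiasable if its debiased cost is nonnegative. -/
def Debiasable {S : Type*} (C : S → S → EReal) : Prop :=
  (∀ x y, C x y = C y x) ∧ (∀ x y, C x y ≠ ⊥) ∧ ∀ x y, 0 ≤ debiasedCost C x y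

/-- Negative definite (real-valued) cost: symmetric and conditionally negative semidefinite. -/
def NegativeDefiniteCost {X : Type*} (c : X → X → ℝ) : Prop :=
  (∀ x y, c x y = c y x) ∧
    ∀ (N : ℕ) (x : Fin N → X) (a : Fin N → ℝ), ∑ i, a i = 0 →
      ∑ i, ∑ j, a i * a j * c (x i) (x j) ≤ 0

/-- Couplings of `μ` and `ν`: measures on the product with marginals `μ` and `ν`. -/
def couplings {X Y : Type*} [MeasurableSpace X] [MeasurableSpace Y]
    (μ : Measure X) (ν : Measure Y) : Set (Measure (X × Y)) :=
  {π | π.map Prod.fst = μ ∧ π.map Prod.snd = ν}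

/-- The integral of a real function as an extended real number:
`∫ f⁺ - ∫ f⁻`, with the rule `∞ - ∞ = +∞`. -/
def extIntegral {Ω : Type*} [MeasurableSpace Ω] (f : Ω → ℝ) (π : Measure Ω) : EReal :=
  upperAdd ((∫⁻ ω, ENNReal.ofReal (f ω) ∂π : ℝ≥0∞) : EReal)
    (-((∫⁻ ω, ENNReal.ofReal (-f ω) ∂π : ℝ≥0∞) : EReal))

/-- Entropic optimal transport:
`inf_{π ∈ Π(μ,ν)} ∫ c dπ + ε KL(π | μ ⊗ ν)`. -/
def entropicOT {X Y : Type*} [MeasurableSpace X] [MeasurableSpace Y]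
    (ε : ℝ) (c : X → Y → ℝ) (μ : Measure X) (ν : Measure Y) : EReal :=
  ⨅ π ∈ couplings μ ν,
    upperAdd (extIntegral (fun p : X × Y => c p.1 p.2) π)
      ((ENNReal.ofReal ε * InformationTheory.klDiv π (μ.prod ν) : ℝ≥0∞) : EReal)

/-- The log-sum-exp cost `-ε log ∫ exp (-(ψ(x,z) + ψ(y,z)) / ε) dm(z)`. -/
def lseCost {X Z : Type*} [MeasurableSpace Z] (ε : ℝ) (m : Measure Z) (ψ : X → Z → ℝ)
    (x y : X) : ℝ :=
  -ε * Real.log (∫ z, Real.exp (-(ψ x z + ψ y z) / ε) ∂m)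

/-- The product Gaussian probability measure `⊗_{i ∈ ℕ} N(0,1)` on `ℝ^ℕ`. -/
def gaussianSeq : Measure (ℕ → ℝ) := Measure.infinitePi fun _ : ℕ => gaussianReal 0 1

/-- Probability measures for which the negative part of the diagonal `x ↦ c(x,x)` is integrable.
This is every probability measure when `c` is bounded below on the diagonal. -/
def AdmissibleMeasure {X : Type*} [MeasurableSpace X] (c : X → X → ℝ) : Type _ :=
  {μ : ProbabilityMeasure X // Integrable (fun x => max (-c x x) 0) (μ : Measure X)}

end

/-!
The argument separates the Gaussian computation from the optimal transport.

*The factorization.* Fixing a base point, a negative definite cost yields the positive semidefinite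
kernel of Schoenberg's theorem. Since `c` is continuous and `X` is separable, its features span a
separable Hilbert space, and an isometry of this space into `ℓ²` gives the feature map `φ`
(`NegativeDefiniteCost.exists_featureMap`). For `v ∈ ℓ²` the series `∑ i, v i * z i` converges
almost surely and is Gaussian with variance `‖v‖²` (`ae_tendsto_gaussianSeries`,
`map_gaussianSeries`), so that its exponential moments are explicit. With `θ = log ρ`, the log
Gaussian factor of the statement, and `k = c / ε`, this reads `∫ exp (θ x + θ y) dλ = exp (-k x y)`
(`isLatentFactorization_gaussianFactor`). Apart from one integrability statement for the equality
case, only this identity (`IsLatentFactorization`) enters the rest of the proof.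

*From latent couplings to couplings.* Two couplings `π₁ ∈ Π(μ, η)` and `π₂ ∈ Π(ν, η)` are glued
along the latent variable, with `x` and `y` conditionally independent given `z`
(`exists_gluing`). By the chain rule the glued law has relative entropy
`KL(π₁ | μ ⊗ η) + KL(π₂ | ν ⊗ η)` with respect to `μ ⊗ ν ⊗ η`. Disintegrating it over `(x, y)`
instead and applying the Gibbs variational inequality to each conditional law of `z` bounds the
entropic cost of its `(x, y)`-marginal (`exists_coupling_of_latent`), which gives the upper bound
`IsLatentFactorization.entropicOT_le_latent`.

*From couplings to latent couplings.* Conversely the Gibbs inequality is an equality when, given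
`(x, y)`, the latent variable has density `exp (θ x + θ y + k x y)` with respect to `λ`; this is
`latentLift`. Passing from the lift to its marginals on `(x, z)` and `(y, z)` discards the
conditional dependence of `x` and `y` given `z`, which cannot increase the entropy, so these
marginals have a total latent cost at most the entropic cost of the coupling
(`IsLatentFactorization.latent_cost_le`). The point requiring care is that `θ` and
`log (dη/dλ)`, where `η` is the law of `z`, need not be integrable separately. The differences
`θ x - log (dη/dλ) / 2` are: the mutual informations of `(x, z)` and `(y, z)` are finite, as one
sees by comparing the lift with the reference law of `z` given `(y, y)`
(`IsLatentFactorization.klDiv_latentLift_prod_ne_top`), and the moment identity controls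
`θ x - θ y` (`IsLatentFactorization.integrable_factor_sub`). Hence the latent cost is always written
with these differences.

*Conclusion.* If `c` is integrable for `μ ⊗ ν`, then `‖φ‖²` is integrable for both marginals, `θ` is
integrable for the lift, and the cost of the lift splits into the three terms of the latent problem
(`IsLatentFactorization.iInf_latent_le_entropicOT`). For debiasing no splitting is needed: the two
couplings obtained by lifting are each glued with themselves, which bounds
`OT(μ, μ) / 2 + OT(ν, ν) / 2` by `OT(μ, ν)` without any integrability of `c` for `μ ⊗ ν`
(`IsLatentFactorization.exists_self_costs`).
-/

/-! ### Relative entropy -/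

open InformationTheory in
theorem klDiv_map_measurableEquiv {α β : Type*} [MeasurableSpace α] [MeasurableSpace β]
    (e : α ≃ᵐ β) (μ ν : Measure α) [IsFiniteMeasure μ] [IsFiniteMeasure ν] :
    klDiv (μ.map e) (ν.map e) = klDiv μ ν := by
  refine le_antisymm (klDiv_map_le _ _ e.measurable) ?_
  have := klDiv_map_le (μ.map e) (ν.map e) e.symm.measurable
  simpa [Measure.map_map e.symm.measurable e.measurable] using this

open InformationTheory in
/-- Chain rule for the relative entropy with respect to a product measure, splitting off the first
marginal. -/
theorem klDiv_prod_eq_add_fst {α β : Type*} [MeasurableSpace α] [MeasurableSpace β]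
    [StandardBorelSpace β] [Nonempty β] (γ : Measure (α × β)) [IsFiniteMeasure γ]
    (m : Measure α) [IsFiniteMeasure m] (q : Measure β) [IsProbabilityMeasure q] :
    klDiv γ (m.prod q) = klDiv γ.fst m + klDiv γ (γ.fst.prod q) := by
  have := klDiv_compProd_eq_add γ.fst m γ.condKernel (Kernel.const α q)
  rwa [γ.disintegrate γ.condKernel, Measure.compProd_const, Measure.compProd_const] at this

open InformationTheory in
/-- Chain rule for the relative entropy with respect to a product measure, splitting off the second
marginal. -/
theorem klDiv_prod_eq_add_snd {α β : Type*} [MeasurableSpace α] [MeasurableSpace β]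
    [StandardBorelSpace α] [Nonempty α] (γ : Measure (α × β)) [IsFiniteMeasure γ]
    (m : Measure α) [IsProbabilityMeasure m] (q : Measure β) [IsFiniteMeasure q] :
    klDiv γ (m.prod q) = klDiv γ.snd q + klDiv γ (m.prod γ.snd) := by
  have h := klDiv_prod_eq_add_fst (γ.map Prod.swap) q m
  have e1 : (γ.map Prod.swap).fst = γ.snd := Measure.fst_map_swap
  have key (r : Measure β) [IsFiniteMeasure r] :
      klDiv (γ.map Prod.swap) (r.prod m) = klDiv γ (m.prod r) := by
    rw [← Measure.prod_swap]
    exact klDiv_map_measurableEquiv MeasurableEquiv.prodComm γ (m.prod r)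
  rwa [e1, key, key] at h

/-- Change of measure: for `γ ≪ Q`, integrating `exp (w - log dγ/dQ)` against `γ` amounts to
integrating `exp w` against `Q` over the set where the density of `γ` is positive. -/
theorem lintegral_exp_sub_llr_le {Ω : Type*} [MeasurableSpace Ω] (γ Q : Measure Ω)
    [IsFiniteMeasure γ] [IsFiniteMeasure Q] (hac : γ ≪ Q) {w : Ω → ℝ} (hw : Measurable w) :
    ∫⁻ x, ENNReal.ofReal (Real.exp (w x - llr γ Q x)) ∂γ
      ≤ ∫⁻ x, ENNReal.ofReal (Real.exp (w x)) ∂Q := by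
  have hmeas : Measurable fun x => ENNReal.ofReal (Real.exp (w x - llr γ Q x)) :=
    (Real.measurable_exp.comp (hw.sub (measurable_llr γ Q))).ennreal_ofReal
  rw [← lintegral_rnDeriv_mul hac hmeas.aemeasurable]
  refine lintegral_mono_ae ?_
  filter_upwards [Measure.rnDeriv_lt_top γ Q] with x hx
  simp only [llr]
  rcases eq_or_ne (γ.rnDeriv Q x) 0 with h0 | h0
  · simp [h0]
  · have hpos : 0 < (γ.rnDeriv Q x).toReal := ENNReal.toReal_pos h0 hx.ne
    conv_lhs => rw [← ENNReal.ofReal_toReal hx.ne]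
    rw [← ENNReal.ofReal_mul hpos.le, ENNReal.toReal_ofReal hpos.le, Real.exp_sub,
      Real.exp_log hpos, mul_div_cancel₀ _ hpos.ne']

/-- Entropy inequality (Gibbs variational principle): a function with `∫ exp w dQ ≤ 1` has
`γ`-integrable positive part whenever `γ` has finite entropy relative to `Q`. -/
theorem integrable_posPart_of_lintegral_exp_le {Ω : Type*} [MeasurableSpace Ω] (γ Q : Measure Ω)
    [IsProbabilityMeasure γ] [IsProbabilityMeasure Q] (hkl : InformationTheory.klDiv γ Q ≠ ⊤)
    {w : Ω → ℝ} (hw : Measurable w) (hexp : ∫⁻ x, ENNReal.ofReal (Real.exp (w x)) ∂Q ≤ 1) :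
    Integrable (fun x => max (w x) 0) γ := by
  obtain ⟨hac, hint⟩ := InformationTheory.klDiv_ne_top_iff.1 hkl
  have h1 := (lintegral_exp_sub_llr_le γ Q hac hw).trans hexp
  have hu : Measurable fun x => w x - llr γ Q x := hw.sub (measurable_llr γ Q)
  have hE : Integrable (fun x => Real.exp (w x - llr γ Q x)) γ := by
    refine ⟨(Real.measurable_exp.comp hu).aestronglyMeasurable, ?_⟩
    rw [hasFiniteIntegral_iff_ofReal (ae_of_all _ fun x => (Real.exp_pos _).le)]
    exact h1.trans_lt ENNReal.one_lt_top
  refine (hE.add hint.abs).mono' (hw.max measurable_const).aestronglyMeasurable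
    (ae_of_all _ fun x => ?_)
  simp only [Pi.add_apply]
  rw [Real.norm_of_nonneg (le_max_right _ _)]
  have h2 := Real.add_one_le_exp (w x - llr γ Q x)
  have h3 := le_abs_self (llr γ Q x)
  have h4 := abs_nonneg (llr γ Q x)
  have h5 := Real.exp_pos (w x - llr γ Q x)
  exact max_le (by linarith) (by linarith)

/-- Entropy inequality (Gibbs variational principle): `∫ w dγ ≤ KL(γ | Q)` if
`∫ exp w dQ ≤ 1`. -/
theorem integral_le_toReal_klDiv {Ω : Type*} [MeasurableSpace Ω] (γ Q : Measure Ω)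
    [IsProbabilityMeasure γ] [IsProbabilityMeasure Q] (hkl : InformationTheory.klDiv γ Q ≠ ⊤)
    {w : Ω → ℝ} (hw : Measurable w) (hexp : ∫⁻ x, ENNReal.ofReal (Real.exp (w x)) ∂Q ≤ 1)
    (hwi : Integrable w γ) :
    ∫ x, w x ∂γ ≤ (InformationTheory.klDiv γ Q).toReal := by
  obtain ⟨hac, hint⟩ := InformationTheory.klDiv_ne_top_iff.1 hkl
  have h1 := (lintegral_exp_sub_llr_le γ Q hac hw).trans hexp
  have hu : Measurable fun x => w x - llr γ Q x := hw.sub (measurable_llr γ Q)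
  have hE : Integrable (fun x => Real.exp (w x - llr γ Q x)) γ := by
    refine ⟨(Real.measurable_exp.comp hu).aestronglyMeasurable, ?_⟩
    rw [hasFiniteIntegral_iff_ofReal (ae_of_all _ fun x => (Real.exp_pos _).le)]
    exact h1.trans_lt ENNReal.one_lt_top
  have h2 : ∫ x, Real.exp (w x - llr γ Q x) ∂γ ≤ 1 := by
    rw [integral_eq_lintegral_of_nonneg_ae (ae_of_all _ fun x => (Real.exp_pos _).le)
      hE.aestronglyMeasurable]
    exact ENNReal.toReal_le_of_le_ofReal zero_le_one (by simpa using h1)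
  have h3 : ∫ x, (w x - llr γ Q x + 1) ∂γ ≤ ∫ x, Real.exp (w x - llr γ Q x) ∂γ :=
    integral_mono ((hwi.sub hint).add (integrable_const 1)) hE
      fun x => Real.add_one_le_exp _
  rw [integral_add (f := fun x => w x - llr γ Q x) (hwi.sub hint) (integrable_const 1),
    integral_sub hwi hint] at h3
  rw [InformationTheory.toReal_klDiv_of_measure_eq hac (by simp)]
  simp only [integral_const, probReal_univ, smul_eq_mul, mul_one] at h3
  linarith

/-- The log-likelihood ratio of two measures given by densities against a common reference. -/
theorem llr_withDensity_withDensity {Ω : Type*} [MeasurableSpace Ω] (Q : Measure Ω)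
    [IsFiniteMeasure Q] {f g : Ω → ℝ≥0∞} (hf : Measurable f) (hg : Measurable g)
    [IsFiniteMeasure (Q.withDensity f)] [IsFiniteMeasure (Q.withDensity g)]
    (hac : Q.withDensity f ≪ Q.withDensity g) :
    ∀ᵐ x ∂(Q.withDensity f), llr (Q.withDensity f) (Q.withDensity g) x
      = Real.log (f x).toReal - Real.log (g x).toReal := by
  have hfR : Q.withDensity f ≪ Q := withDensity_absolutelyContinuous _ _
  have h1 := hfR.ae_le (Measure.rnDeriv_mul_rnDeriv (κ := Q) hac)
  have h2 := hfR.ae_le (Measure.rnDeriv_withDensity Q hf)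
  have h3 := hfR.ae_le (Measure.rnDeriv_withDensity Q hg)
  have h4 := hfR.ae_le (Measure.rnDeriv_lt_top (Q.withDensity f) Q)
  have h5 := hfR.ae_le (Measure.rnDeriv_lt_top (Q.withDensity g) Q)
  have h6 := hac.ae_le (Measure.rnDeriv_lt_top (Q.withDensity f) (Q.withDensity g))
  have h7 := Measure.rnDeriv_pos hfR
  filter_upwards [h1, h2, h3, h4, h5, h6, h7] with x h1 h2 h3 h4 h5 h6 h7
  simp only [Pi.mul_apply] at h1
  rw [h2] at h1 h4 h7
  rw [h3] at h1 h5
  have hg0 : g x ≠ 0 := by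
    rintro h0
    rw [h0, mul_zero] at h1
    exact h7.ne h1
  have hr0 : (Q.withDensity f).rnDeriv (Q.withDensity g) x ≠ 0 := by
    rintro h0
    rw [h0, zero_mul] at h1
    exact h7.ne h1
  rw [llr, ← h1, ENNReal.toReal_mul, Real.log_mul (ENNReal.toReal_pos hr0 h6.ne).ne'
    (ENNReal.toReal_pos hg0 h5.ne).ne']
  ring

/-! ### Couplings and gluing -/

theorem map_swap_mem_couplings {X Y : Type*} [MeasurableSpace X] [MeasurableSpace Y]
    {μ : Measure X} {ν : Measure Y} {π : Measure (X × Y)} (hπ : π ∈ couplings μ ν) :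
    π.map Prod.swap ∈ couplings ν μ := by
  refine ⟨?_, ?_⟩
  · rw [Measure.map_map measurable_fst measurable_swap]
    exact hπ.2
  · rw [Measure.map_map measurable_snd measurable_swap]
    exact hπ.1

theorem isProbabilityMeasure_of_mem_couplings {X Y : Type*} [MeasurableSpace X]
    [MeasurableSpace Y] {μ : Measure X} [IsProbabilityMeasure μ] {ν : Measure Y}
    {π : Measure (X × Y)} (hπ : π ∈ couplings μ ν) : IsProbabilityMeasure π := by
  have : IsProbabilityMeasure (π.map Prod.fst) := by rw [hπ.1]; infer_instance
  exact Measure.isProbabilityMeasure_of_map Prod.fst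

theorem integrable_comp_fst_of_mem_couplings {X Y : Type*} [MeasurableSpace X]
    [MeasurableSpace Y] {μ : Measure X} {ν : Measure Y} {π : Measure (X × Y)}
    (hπ : π ∈ couplings μ ν) {f : X → ℝ} (hf : Integrable f μ) :
    Integrable (fun p => f p.1) π := by
  rw [← hπ.1] at hf
  exact hf.comp_measurable measurable_fst

theorem integrable_comp_snd_of_mem_couplings {X Y : Type*} [MeasurableSpace X]
    [MeasurableSpace Y] {μ : Measure X} {ν : Measure Y} {π : Measure (X × Y)}
    (hπ : π ∈ couplings μ ν) {f : Y → ℝ} (hf : Integrable f ν) :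
    Integrable (fun p => f p.2) π := by
  rw [← hπ.2] at hf
  exact hf.comp_measurable measurable_snd

/-- Given a base point, the two draws from `κ` and `ξ` are conditionally independent, so their
order may be exchanged. -/
theorem map_exchange_compProd {X Y Z : Type*} [MeasurableSpace X] [MeasurableSpace Y]
    [MeasurableSpace Z] (η : Measure Z) [SFinite η] (κ : Kernel Z X) [IsMarkovKernel κ]
    (ξ : Kernel Z Y) [IsMarkovKernel ξ] :
    ((η ⊗ₘ κ) ⊗ₘ (Kernel.prodMkRight X ξ)).map
        (fun p : (Z × X) × Y => ((p.1.1, p.2), p.1.2))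
      = (η ⊗ₘ ξ) ⊗ₘ (Kernel.prodMkRight Y κ) := by
  refine Measure.ext_of_lintegral _ fun f hf => ?_
  have hm : Measurable fun p : (Z × X) × Y => ((p.1.1, p.2), p.1.2) := by fun_prop
  rw [lintegral_map hf hm, Measure.lintegral_compProd (by fun_prop),
    Measure.lintegral_compProd (by fun_prop), Measure.lintegral_compProd (by fun_prop),
    Measure.lintegral_compProd (by fun_prop)]
  refine lintegral_congr fun z => ?_
  simp only [Kernel.prodMkRight_apply]
  rw [lintegral_lintegral_swap (by fun_prop)]

open InformationTheory in
/-- Relative entropy of a conditionally independent gluing: the two contributions add up. -/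
theorem klDiv_compProd_prodMkRight {X Y Z : Type*} [MeasurableSpace X] [MeasurableSpace Y]
    [MeasurableSpace Z] (η : Measure Z) [IsFiniteMeasure η] (κ : Kernel Z X) [IsMarkovKernel κ]
    (ξ : Kernel Z Y) [IsMarkovKernel ξ] (μ : Measure X) [IsProbabilityMeasure μ]
    (ν : Measure Y) [IsProbabilityMeasure ν] :
    klDiv ((η ⊗ₘ κ) ⊗ₘ (Kernel.prodMkRight X ξ)) ((η.prod μ).prod ν)
      = klDiv (η ⊗ₘ κ) (η.prod μ) + klDiv (η ⊗ₘ ξ) (η.prod ν) := by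
  have hν : Kernel.prodMkRight X (Kernel.const Z ν) = Kernel.const (Z × X) ν := by
    ext; simp
  have e1 : (η.prod μ).prod ν
      = (η ⊗ₘ Kernel.const Z μ) ⊗ₘ Kernel.const (Z × X) ν := by
    rw [Measure.compProd_const, Measure.compProd_const]
  rw [e1, klDiv_compProd_eq_add, Measure.compProd_const]
  congr 1
  -- exchanging the two conditionally independent coordinates makes `κ` the common kernel
  let e : (Z × X) × Y ≃ᵐ (Z × Y) × X :=
    { toFun := fun p => ((p.1.1, p.2), p.1.2)
      invFun := fun p => ((p.1.1, p.2), p.1.2)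
      left_inv := fun _ => rfl
      right_inv := fun _ => rfl
      measurable_toFun := by
        change Measurable fun p : (Z × X) × Y => ((p.1.1, p.2), p.1.2)
        fun_prop
      measurable_invFun := by
        change Measurable fun p : (Z × Y) × X => ((p.1.1, p.2), p.1.2)
        fun_prop }
  rw [← klDiv_map_measurableEquiv e, ← hν]
  have h1 := map_exchange_compProd η κ ξ
  have h2 := map_exchange_compProd η κ (Kernel.const Z ν)
  change klDiv (Measure.map (fun p : (Z × X) × Y => ((p.1.1, p.2), p.1.2)) _)
    (Measure.map (fun p : (Z × X) × Y => ((p.1.1, p.2), p.1.2)) _) = _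
  rw [h1, h2, klDiv_compProd_left, Measure.compProd_const]

open InformationTheory in
/-- Gluing: couplings of `(μ, η)` and `(ν, η)` are the marginals of a measure under which the first
two coordinates are conditionally independent given the third; the relative entropies add up. -/
theorem exists_gluing {X Y Z : Type*} [MeasurableSpace X] [StandardBorelSpace X] [Nonempty X]
    [MeasurableSpace Y] [StandardBorelSpace Y] [Nonempty Y] [MeasurableSpace Z]
    {μ : Measure X} [IsProbabilityMeasure μ] {ν : Measure Y} [IsProbabilityMeasure ν]
    {η : Measure Z} [IsProbabilityMeasure η] {π₁ : Measure (X × Z)} {π₂ : Measure (Y × Z)}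
    (h₁ : π₁ ∈ couplings μ η) (h₂ : π₂ ∈ couplings ν η) :
    ∃ γ : Measure ((X × Y) × Z), IsProbabilityMeasure γ ∧
      γ.map (fun p => (p.1.1, p.2)) = π₁ ∧ γ.map (fun p => (p.1.2, p.2)) = π₂ ∧
      klDiv γ ((μ.prod ν).prod η) = klDiv π₁ (μ.prod η) + klDiv π₂ (ν.prod η) := by
  have := isProbabilityMeasure_of_mem_couplings h₁
  have := isProbabilityMeasure_of_mem_couplings h₂
  have p₁ : IsProbabilityMeasure (π₁.map Prod.swap) :=
    Measure.isProbabilityMeasure_map measurable_swap.aemeasurable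
  have p₂ : IsProbabilityMeasure (π₂.map Prod.swap) :=
    Measure.isProbabilityMeasure_map measurable_swap.aemeasurable
  set κ := (π₁.map Prod.swap).condKernel
  set ξ := (π₂.map Prod.swap).condKernel
  have f₁ : (π₁.map Prod.swap).fst = η := Measure.fst_map_swap.trans h₁.2
  have f₂ : (π₂.map Prod.swap).fst = η := Measure.fst_map_swap.trans h₂.2
  have d₁ : η ⊗ₘ κ = π₁.map Prod.swap := by
    conv_lhs => rw [← f₁]
    exact (π₁.map Prod.swap).disintegrate κ
  have d₂ : η ⊗ₘ ξ = π₂.map Prod.swap := by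
    conv_lhs => rw [← f₂]
    exact (π₂.map Prod.swap).disintegrate ξ
  let e : (Z × X) × Y ≃ᵐ (X × Y) × Z :=
    { toFun := fun p => ((p.1.2, p.2), p.1.1)
      invFun := fun p => ((p.2, p.1.1), p.1.2)
      left_inv := fun _ => rfl
      right_inv := fun _ => rfl
      measurable_toFun := by
        change Measurable fun p : (Z × X) × Y => ((p.1.2, p.2), p.1.1)
        fun_prop
      measurable_invFun := by
        change Measurable fun p : (X × Y) × Z => ((p.2, p.1.1), p.1.2)
        fun_prop }
  have he : ⇑e = fun p => ((p.1.2, p.2), p.1.1) := rfl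
  set Γ := (η ⊗ₘ κ) ⊗ₘ (Kernel.prodMkRight X ξ) with hΓ
  have hs₁ : (π₁.map Prod.swap).map Prod.swap = π₁ := by
    rw [Measure.map_map measurable_swap measurable_swap]; simp
  have hs₂ : (π₂.map Prod.swap).map Prod.swap = π₂ := by
    rw [Measure.map_map measurable_swap measurable_swap]; simp
  refine ⟨Γ.map e, Measure.isProbabilityMeasure_map e.measurable.aemeasurable, ?_, ?_, ?_⟩
  · rw [Measure.map_map (by fun_prop) e.measurable, ← hs₁, ← d₁,
      ← Measure.fst_compProd (η ⊗ₘ κ) (Kernel.prodMkRight X ξ), Measure.fst,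
      Measure.map_map measurable_swap measurable_fst]
    rfl
  · rw [Measure.map_map (by fun_prop) e.measurable, ← hs₂, ← d₂,
      ← Measure.fst_compProd (η ⊗ₘ ξ) (Kernel.prodMkRight Y κ), ← map_exchange_compProd η κ ξ,
      Measure.fst, Measure.map_map measurable_fst (by fun_prop),
      Measure.map_map measurable_swap (by fun_prop)]
    rfl
  · have href : ((η.prod μ).prod ν).map e = (μ.prod ν).prod η := by
      refine Measure.ext_of_lintegral _ fun f hf => ?_
      rw [lintegral_map hf e.measurable, he, lintegral_prod _ (by fun_prop),
        lintegral_prod _ (by fun_prop), lintegral_prod_symm _ (by fun_prop)]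
      refine lintegral_congr fun z => ?_
      rw [lintegral_prod _ (by fun_prop)]
    rw [← href, klDiv_map_measurableEquiv, klDiv_compProd_prodMkRight, d₁, d₂]
    congr 1
    · rw [← Measure.prod_swap]
      exact klDiv_map_measurableEquiv MeasurableEquiv.prodComm π₁ (μ.prod η)
    · rw [← Measure.prod_swap]
      exact klDiv_map_measurableEquiv MeasurableEquiv.prodComm π₂ (ν.prod η)

/-! ### From latent couplings to couplings -/

/-- The kernel `exp (-k)` factors through the latent probability space `(Z, lam)` with positive
factors `exp (θ x ·)`, that is `exp (-k x y) = ∫ exp (θ x z) exp (θ y z) dlam(z)`. -/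
structure IsLatentFactorization {X Z : Type*} [MeasurableSpace X] [MeasurableSpace Z]
    (lam : Measure Z) (θ : X → Z → ℝ) (k : X → X → ℝ) : Prop where
  measurable_factor : Measurable fun p : X × Z => θ p.1 p.2
  measurable_cost : Measurable fun p : X × X => k p.1 p.2
  lintegral_exp : ∀ x y, ∫⁻ z, ENNReal.ofReal (Real.exp (θ x z + θ y z)) ∂lam
    = ENNReal.ofReal (Real.exp (-k x y))

theorem IsLatentFactorization.symm {X Z : Type*} [MeasurableSpace X] [MeasurableSpace Z]
    {lam : Measure Z} {θ : X → Z → ℝ} {k : X → X → ℝ} (h : IsLatentFactorization lam θ k)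
    (x y : X) : k x y = k y x := by
  have h1 := h.lintegral_exp x y
  simp_rw [add_comm (θ x _)] at h1
  rw [h.lintegral_exp y x, ENNReal.ofReal_eq_ofReal_iff (Real.exp_pos _).le (Real.exp_pos _).le,
    Real.exp_eq_exp] at h1
  linarith

/-- The conditional density of the latent variable given `(x, y)` is normalized. -/
theorem IsLatentFactorization.lintegral_exp_add {X Z : Type*} [MeasurableSpace X]
    [MeasurableSpace Z] {lam : Measure Z} {θ : X → Z → ℝ} {k : X → X → ℝ}
    (h : IsLatentFactorization lam θ k) (x y : X) :
    ∫⁻ z, ENNReal.ofReal (Real.exp (θ x z + θ y z + k x y)) ∂lam = 1 := by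
  have hx : Measurable (θ x) := h.measurable_factor.comp measurable_prodMk_left
  have hy : Measurable (θ y) := h.measurable_factor.comp measurable_prodMk_left
  simp_rw [Real.exp_add _ (k x y), ENNReal.ofReal_mul (Real.exp_pos _).le]
  rw [lintegral_mul_const _ (by fun_prop), h.lintegral_exp, ← ENNReal.ofReal_mul (Real.exp_pos _).le,
    ← Real.exp_add]
  simp

/-- Couplings of `μ` and of `ν` with a common latent measure `η ≪ lam` produce a coupling of `μ`
and `ν` whose entropic cost for `k` is at most the total latent cost. The latent cost is grouped as
`KL - ∫ (θ - log (dη/dlam) / 2)`, so that neither `θ` nor `log (dη/dlam)` has to be integrable on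
its own. -/
theorem exists_coupling_of_latent {X Z : Type*} [MeasurableSpace X] [StandardBorelSpace X]
    [Nonempty X] [MeasurableSpace Z] [StandardBorelSpace Z] [Nonempty Z]
    {lam : Measure Z} [IsProbabilityMeasure lam] {θ : X → Z → ℝ} {k : X → X → ℝ}
    (hf : IsLatentFactorization lam θ k)
    {μ ν : Measure X} [IsProbabilityMeasure μ] [IsProbabilityMeasure ν]
    {η : Measure Z} [IsProbabilityMeasure η] (hac : η ≪ lam)
    {π₁ π₂ : Measure (X × Z)} (h₁ : π₁ ∈ couplings μ η) (h₂ : π₂ ∈ couplings ν η)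
    (kl₁ : InformationTheory.klDiv π₁ (μ.prod η) ≠ ⊤)
    (kl₂ : InformationTheory.klDiv π₂ (ν.prod η) ≠ ⊤)
    (A₁ : Integrable (fun p => θ p.1 p.2 - llr η lam p.2 / 2) π₁)
    (A₂ : Integrable (fun p => θ p.1 p.2 - llr η lam p.2 / 2) π₂)
    (hneg : ∀ π ∈ couplings μ ν, Integrable (fun p => max (-k p.1 p.2) 0) π) :
    ∃ π ∈ couplings μ ν, Integrable (fun p => k p.1 p.2) π ∧
      InformationTheory.klDiv π (μ.prod ν) ≠ ⊤ ∧
      ∫ p, k p.1 p.2 ∂π + (InformationTheory.klDiv π (μ.prod ν)).toReal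
        ≤ ((InformationTheory.klDiv π₁ (μ.prod η)).toReal
            - ∫ p, (θ p.1 p.2 - llr η lam p.2 / 2) ∂π₁)
          + ((InformationTheory.klDiv π₂ (ν.prod η)).toReal
            - ∫ p, (θ p.1 p.2 - llr η lam p.2 / 2) ∂π₂) := by
  have hθ := hf.measurable_factor
  have hk := hf.measurable_cost
  obtain ⟨γ, hγ, m₁, m₂, hkl⟩ := exists_gluing h₁ h₂
  have q₁ : Measurable fun p : (X × X) × Z => (p.1.1, p.2) := by fun_prop
  have q₂ : Measurable fun p : (X × X) × Z => (p.1.2, p.2) := by fun_prop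
  have hπ : γ.fst ∈ couplings μ ν := by
    refine ⟨?_, ?_⟩
    · rw [Measure.fst, Measure.map_map measurable_fst measurable_fst, ← h₁.1, ← m₁,
        Measure.map_map measurable_fst q₁]
      rfl
    · rw [Measure.fst, Measure.map_map measurable_snd measurable_fst, ← h₂.1, ← m₂,
        Measure.map_map measurable_fst q₂]
      rfl
  have hchain := klDiv_prod_eq_add_fst γ (μ.prod ν) η
  rw [hkl] at hchain
  have hsum : InformationTheory.klDiv γ.fst (μ.prod ν)
      + InformationTheory.klDiv γ (γ.fst.prod η) ≠ ⊤ := by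
    rw [← hchain]; exact ENNReal.add_ne_top.2 ⟨kl₁, kl₂⟩
  obtain ⟨klπ, klγ⟩ := ENNReal.add_ne_top.1 hsum
  have hreal := congrArg ENNReal.toReal hchain
  rw [ENNReal.toReal_add kl₁ kl₂, ENNReal.toReal_add klπ klγ] at hreal
  have hll : Measurable (llr η lam) := measurable_llr η lam
  have t₁ : Measurable fun p : (X × X) × Z => θ p.1.1 p.2 := hθ.comp q₁
  have t₂ : Measurable fun p : (X × X) × Z => θ p.1.2 p.2 := hθ.comp q₂
  have tk : Measurable fun p : (X × X) × Z => k p.1.1 p.1.2 := hk.comp measurable_fst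
  -- log-density, relative to `η`, of the conditional law of the latent variable given `(x, y)`
  let w : (X × X) × Z → ℝ := fun p => θ p.1.1 p.2 + θ p.1.2 p.2 + k p.1.1 p.1.2 - llr η lam p.2
  have hw : Measurable w := ((t₁.add t₂).add tk).sub (hll.comp measurable_snd)
  have hexp : ∫⁻ p, ENNReal.ofReal (Real.exp (w p)) ∂(γ.fst.prod η) ≤ 1 := by
    rw [lintegral_prod _ (by fun_prop)]
    calc ∫⁻ q, ∫⁻ z, ENNReal.ofReal (Real.exp (w (q, z))) ∂η ∂γ.fst
        ≤ ∫⁻ _, 1 ∂γ.fst := by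
          refine lintegral_mono fun q => ?_
          refine (lintegral_exp_sub_llr_le η lam hac
            (w := fun z => θ q.1 z + θ q.2 z + k q.1 q.2) ?_).trans
              (hf.lintegral_exp_add q.1 q.2).le
          exact ((t₁.add t₂).add tk).comp (measurable_prodMk_left (x := q))
      _ = 1 := by simp
  have hwpos := integrable_posPart_of_lintegral_exp_le γ (γ.fst.prod η) klγ hw hexp
  have B₁ : Integrable (fun p : (X × X) × Z => θ p.1.1 p.2 - llr η lam p.2 / 2) γ := by
    rw [← m₁] at A₁; exact A₁.comp_measurable q₁
  have B₂ : Integrable (fun p : (X × X) × Z => θ p.1.2 p.2 - llr η lam p.2 / 2) γ := by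
    rw [← m₂] at A₂; exact A₂.comp_measurable q₂
  have I₁ : ∫ p, (θ p.1 p.2 - llr η lam p.2 / 2) ∂π₁
      = ∫ p, (θ p.1.1 p.2 - llr η lam p.2 / 2) ∂γ := by
    conv_lhs => rw [← m₁]
    exact integral_map q₁.aemeasurable
      ((hθ.sub ((hll.comp measurable_snd).div_const 2)).aestronglyMeasurable)
  have I₂ : ∫ p, (θ p.1 p.2 - llr η lam p.2 / 2) ∂π₂
      = ∫ p, (θ p.1.2 p.2 - llr η lam p.2 / 2) ∂γ := by
    conv_lhs => rw [← m₂]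
    exact integral_map q₂.aemeasurable
      ((hθ.sub ((hll.comp measurable_snd).div_const 2)).aestronglyMeasurable)
  have hnegγ : Integrable (fun p : (X × X) × Z => max (-k p.1.1 p.1.2) 0) γ :=
    (hneg _ hπ).comp_measurable measurable_fst
  -- `k = w - (A₁ + A₂)`, so its positive part is controlled by that of `w`
  have hkγ : Integrable (fun p : (X × X) × Z => k p.1.1 p.1.2) γ := by
    refine (((hwpos.add B₁.abs).add B₂.abs).add hnegγ).mono' tk.aestronglyMeasurable
      (ae_of_all _ fun p => ?_)
    simp only [Pi.add_apply, w, Real.norm_eq_abs]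
    have a₁ := neg_abs_le (θ p.1.1 p.2 - llr η lam p.2 / 2)
    have a₂ := neg_abs_le (θ p.1.2 p.2 - llr η lam p.2 / 2)
    have a₁' := abs_nonneg (θ p.1.1 p.2 - llr η lam p.2 / 2)
    have a₂' := abs_nonneg (θ p.1.2 p.2 - llr η lam p.2 / 2)
    have a₃ := le_max_left (θ p.1.1 p.2 + θ p.1.2 p.2 + k p.1.1 p.1.2 - llr η lam p.2) 0
    have a₄ := le_max_right (θ p.1.1 p.2 + θ p.1.2 p.2 + k p.1.1 p.1.2 - llr η lam p.2) 0
    have a₅ := le_max_left (-k p.1.1 p.1.2) 0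
    have a₆ := le_max_right (-k p.1.1 p.1.2) 0
    exact abs_le.2 ⟨by linarith, by linarith⟩
  have hwe : w = fun p => (θ p.1.1 p.2 - llr η lam p.2 / 2)
      + (θ p.1.2 p.2 - llr η lam p.2 / 2) + k p.1.1 p.1.2 := by
    funext p; simp only [w]; ring
  have hwi : Integrable w γ := by
    rw [hwe]; exact (B₁.add B₂).add hkγ
  have hwint : ∫ p, w p ∂γ = ∫ p, (θ p.1.1 p.2 - llr η lam p.2 / 2) ∂γ
      + ∫ p, (θ p.1.2 p.2 - llr η lam p.2 / 2) ∂γ + ∫ p, k p.1.1 p.1.2 ∂γ := by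
    rw [hwe]
    exact (integral_add (B₁.add B₂) hkγ).trans (congrArg (· + _) (integral_add B₁ B₂))
  have hfin := integral_le_toReal_klDiv γ (γ.fst.prod η) klγ hw hexp hwi
  have hkπ : ∫ p, k p.1 p.2 ∂γ.fst = ∫ p, k p.1.1 p.1.2 ∂γ :=
    integral_map measurable_fst.aemeasurable hk.aestronglyMeasurable
  refine ⟨γ.fst, hπ, ?_, klπ, ?_⟩
  · exact (integrable_map_measure hk.aestronglyMeasurable measurable_fst.aemeasurable).2 hkγ
  · rw [hwint, ← I₁, ← I₂, ← hkπ] at hfin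
    linarith

/-! ### From couplings to latent couplings -/

/-- The lift of a measure `π` on `X × X` to `(X × X) × Z` under which the conditional law of the
latent variable given `(x, y)` has `lam`-density `exp (θ x z + θ y z + k x y)`. -/
noncomputable def latentLift {X Z : Type*} [MeasurableSpace X] [MeasurableSpace Z]
    (lam : Measure Z) (θ : X → Z → ℝ) (k : X → X → ℝ) (π : Measure (X × X)) :
    Measure ((X × X) × Z) :=
  (π.prod lam).withDensity fun p =>
    ENNReal.ofReal (Real.exp (θ p.1.1 p.2 + θ p.1.2 p.2 + k p.1.1 p.1.2))

section

variable {X Z : Type*} [MeasurableSpace X] [MeasurableSpace Z] {lam : Measure Z}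
  {θ : X → Z → ℝ} {k : X → X → ℝ} {π : Measure (X × X)}

theorem IsLatentFactorization.measurable_latentDensity (h : IsLatentFactorization lam θ k) :
    Measurable fun p : (X × X) × Z =>
      ENNReal.ofReal (Real.exp (θ p.1.1 p.2 + θ p.1.2 p.2 + k p.1.1 p.1.2)) := by
  have t₁ : Measurable fun p : (X × X) × Z => θ p.1.1 p.2 :=
    h.measurable_factor.comp (by fun_prop : Measurable fun p : (X × X) × Z => (p.1.1, p.2))
  have t₂ : Measurable fun p : (X × X) × Z => θ p.1.2 p.2 :=
    h.measurable_factor.comp (by fun_prop : Measurable fun p : (X × X) × Z => (p.1.2, p.2))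
  have t₃ : Measurable fun p : (X × X) × Z => k p.1.1 p.1.2 :=
    h.measurable_cost.comp measurable_fst
  exact (Real.measurable_exp.comp ((t₁.add t₂).add t₃)).ennreal_ofReal

variable [IsProbabilityMeasure lam]

theorem IsLatentFactorization.lintegral_latentLift (h : IsLatentFactorization lam θ k)
    [SFinite π] {F : (X × X) × Z → ℝ≥0∞} (hF : Measurable F) :
    ∫⁻ p, F p ∂(latentLift lam θ k π)
      = ∫⁻ q, ∫⁻ z, ENNReal.ofReal (Real.exp (θ q.1 z + θ q.2 z + k q.1 q.2)) * F (q, z)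
          ∂lam ∂π := by
  rw [latentLift, lintegral_withDensity_eq_lintegral_mul _ h.measurable_latentDensity hF,
    lintegral_prod _ (h.measurable_latentDensity.mul hF).aemeasurable]
  rfl

theorem IsLatentFactorization.fst_latentLift (h : IsLatentFactorization lam θ k) [SFinite π] :
    (latentLift lam θ k π).fst = π := by
  refine Measure.ext_of_lintegral _ fun f hf => ?_
  rw [Measure.fst, lintegral_map hf measurable_fst,
    h.lintegral_latentLift (F := fun p => f p.1) (by fun_prop)]
  refine lintegral_congr fun q => ?_
  have hd : Measurable fun z => ENNReal.ofReal (Real.exp (θ q.1 z + θ q.2 z + k q.1 q.2)) :=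
    h.measurable_latentDensity.comp (measurable_prodMk_left (x := q))
  refine (lintegral_mul_const (f q) hd).trans ?_
  rw [h.lintegral_exp_add, one_mul]

theorem IsLatentFactorization.isProbabilityMeasure_latentLift (h : IsLatentFactorization lam θ k)
    [IsProbabilityMeasure π] : IsProbabilityMeasure (latentLift lam θ k π) := by
  have : IsProbabilityMeasure ((latentLift lam θ k π).map Prod.fst) := by
    rw [← Measure.fst, h.fst_latentLift]; infer_instance
  exact Measure.isProbabilityMeasure_of_map Prod.fst

theorem snd_latentLift_absolutelyContinuous [IsProbabilityMeasure π] :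
    (latentLift lam θ k π).snd ≪ lam := by
  have h1 : latentLift lam θ k π ≪ π.prod lam := withDensity_absolutelyContinuous _ _
  have h2 := h1.map measurable_snd
  rwa [← Measure.snd, ← Measure.snd, Measure.snd_prod] at h2

theorem IsLatentFactorization.latentLift_map_swap (h : IsLatentFactorization lam θ k)
    [SFinite π] : latentLift lam θ k (π.map Prod.swap)
      = (latentLift lam θ k π).map fun p => ((p.1.2, p.1.1), p.2) := by
  have hm : Measurable fun p : (X × X) × Z => ((p.1.2, p.1.1), p.2) := by fun_prop
  refine Measure.ext_of_lintegral _ fun f hf => ?_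
  rw [lintegral_map hf hm, h.lintegral_latentLift hf, h.lintegral_latentLift (by fun_prop)]
  refine (lintegral_map (h.measurable_latentDensity.mul hf).lintegral_prod_right'
    measurable_swap).trans ?_
  refine lintegral_congr fun q => lintegral_congr fun z => ?_
  change ENNReal.ofReal (Real.exp (θ q.2 z + θ q.1 z + k q.2 q.1)) * f ((q.2, q.1), z) = _
  rw [h.symm q.2 q.1, add_comm (θ q.2 z)]

/-- A function is integrable for the lift if its conditional absolute moment given `(x, y)` is
bounded by a `π`-integrable function. -/
theorem IsLatentFactorization.integrable_latentLift (h : IsLatentFactorization lam θ k)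
    [SFinite π] {F : (X × X) × Z → ℝ} (hF : Measurable F) {B : X × X → ℝ} (hB : Integrable B π)
    (hFB : ∀ q, ∫⁻ z, ENNReal.ofReal (Real.exp (θ q.1 z + θ q.2 z + k q.1 q.2))
      * ENNReal.ofReal |F (q, z)| ∂lam ≤ ENNReal.ofReal (B q)) :
    Integrable F (latentLift lam θ k π) := by
  refine ⟨hF.aestronglyMeasurable, ?_⟩
  rw [hasFiniteIntegral_iff_norm]
  simp only [Real.norm_eq_abs]
  rw [h.lintegral_latentLift (by fun_prop)]
  refine (lintegral_mono hFB).trans_lt ?_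
  refine (lintegral_mono fun q => ENNReal.ofReal_le_ofReal (le_abs_self (B q))).trans_lt ?_
  simpa [hasFiniteIntegral_iff_norm] using hB.hasFiniteIntegral

/-- Conditional exponential-moment bounds given `(x, y)`, `E[exp (F - a)] ≤ 1` and
`E[exp (-F - b)] ≤ 1` with `a` and `b` both `π`-integrable, make `F` integrable for the lift. -/
theorem IsLatentFactorization.integrable_latentLift_of_exp (h : IsLatentFactorization lam θ k)
    [IsFiniteMeasure π] {F : (X × X) × Z → ℝ} (hF : Measurable F) {a b : X × X → ℝ}
    (ha : Integrable a π) (hb : Integrable b π)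
    (hFa : ∀ q, ∫⁻ z, ENNReal.ofReal
      (Real.exp (θ q.1 z + θ q.2 z + k q.1 q.2 + (F (q, z) - a q))) ∂lam ≤ 1)
    (hFb : ∀ q, ∫⁻ z, ENNReal.ofReal
      (Real.exp (θ q.1 z + θ q.2 z + k q.1 q.2 + (-F (q, z) - b q))) ∂lam ≤ 1) :
    Integrable F (latentLift lam θ k π) := by
  refine h.integrable_latentLift hF (B := fun q => |a q| + |b q| + 1 + 1)
    (((ha.abs.add hb.abs).add (integrable_const 1)).add (integrable_const 1)) fun q => ?_
  have hd : Measurable fun z =>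
      ENNReal.ofReal (Real.exp (θ q.1 z + θ q.2 z + k q.1 q.2)) :=
    h.measurable_latentDensity.comp (measurable_prodMk_left (x := q))
  have hd' : Measurable fun z => θ q.1 z + θ q.2 z + k q.1 q.2 := by
    have t₁ : Measurable (θ q.1) := h.measurable_factor.comp measurable_prodMk_left
    have t₂ : Measurable (θ q.2) := h.measurable_factor.comp measurable_prodMk_left
    fun_prop
  have hFq : Measurable fun z => F (q, z) := hF.comp (measurable_prodMk_left (x := q))
  have key (z : Z) : |F (q, z)| ≤ |a q| + |b q| + Real.exp (F (q, z) - a q)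
      + Real.exp (-F (q, z) - b q) := by
    have e₁ := Real.add_one_le_exp (F (q, z) - a q)
    have e₂ := Real.add_one_le_exp (-F (q, z) - b q)
    have e₃ := Real.exp_pos (F (q, z) - a q)
    have e₄ := Real.exp_pos (-F (q, z) - b q)
    have e₅ := le_abs_self (a q)
    have e₆ := le_abs_self (b q)
    have e₇ := abs_nonneg (a q)
    have e₈ := abs_nonneg (b q)
    exact abs_le.2 ⟨by linarith, by linarith⟩
  have hab : 0 ≤ |a q| + |b q| := by positivity
  calc ∫⁻ z, ENNReal.ofReal (Real.exp (θ q.1 z + θ q.2 z + k q.1 q.2))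
        * ENNReal.ofReal |F (q, z)| ∂lam
      ≤ ∫⁻ z, (ENNReal.ofReal (Real.exp (θ q.1 z + θ q.2 z + k q.1 q.2))
          * ENNReal.ofReal (|a q| + |b q|)
        + ENNReal.ofReal (Real.exp (θ q.1 z + θ q.2 z + k q.1 q.2 + (F (q, z) - a q)))
        + ENNReal.ofReal
          (Real.exp (θ q.1 z + θ q.2 z + k q.1 q.2 + (-F (q, z) - b q)))) ∂lam := by
        refine lintegral_mono fun z => ?_
        simp only [Real.exp_add _ (F (q, z) - a q), Real.exp_add _ (-F (q, z) - b q)]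
        rw [← ENNReal.ofReal_mul (Real.exp_pos _).le, ← ENNReal.ofReal_mul (Real.exp_pos _).le,
          ← ENNReal.ofReal_add (by positivity) (by positivity),
          ← ENNReal.ofReal_add (by positivity) (by positivity), ← mul_add, ← mul_add]
        exact ENNReal.ofReal_le_ofReal (mul_le_mul_of_nonneg_left (key z) (Real.exp_pos _).le)
    _ ≤ ENNReal.ofReal (|a q| + |b q|) + 1 + 1 := by
        rw [lintegral_add_right _ (by fun_prop), lintegral_add_right _ (by fun_prop),
          lintegral_mul_const _ hd, h.lintegral_exp_add, one_mul]
        gcongr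
        · exact hFa q
        · exact hFb q
    _ = ENNReal.ofReal (|a q| + |b q| + 1 + 1) := by
        rw [ENNReal.ofReal_add (by positivity) zero_le_one,
          ENNReal.ofReal_add hab zero_le_one, ENNReal.ofReal_one]

/-- Under the lift, the factors at the two endpoints differ by an integrable amount: the
conditional expectation of `exp (θ x - θ y)` given `(x, y)` is `exp (k x y - k x x)`. -/
theorem IsLatentFactorization.integrable_factor_sub (h : IsLatentFactorization lam θ k)
    [IsFiniteMeasure π] (hk : Integrable (fun q => k q.1 q.2) π)
    (hd₁ : Integrable (fun q => k q.1 q.1) π) (hd₂ : Integrable (fun q => k q.2 q.2) π) :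
    Integrable (fun p => θ p.1.1 p.2 - θ p.1.2 p.2) (latentLift lam θ k π) := by
  have t₁ : Measurable fun p : (X × X) × Z => θ p.1.1 p.2 :=
    h.measurable_factor.comp (by fun_prop : Measurable fun p : (X × X) × Z => (p.1.1, p.2))
  have t₂ : Measurable fun p : (X × X) × Z => θ p.1.2 p.2 :=
    h.measurable_factor.comp (by fun_prop : Measurable fun p : (X × X) × Z => (p.1.2, p.2))
  refine h.integrable_latentLift_of_exp (t₁.sub t₂) (a := fun q => k q.1 q.2 - k q.1 q.1)
    (b := fun q => k q.1 q.2 - k q.2 q.2) (hk.sub hd₁) (hk.sub hd₂) (fun q => ?_) fun q => ?_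
  · rw [← h.lintegral_exp_add q.1 q.1]
    refine (lintegral_congr fun z => ?_).le
    congr 2; simp only; ring
  · rw [← h.lintegral_exp_add q.2 q.2]
    refine (lintegral_congr fun z => ?_).le
    congr 2; simp only; ring

end

theorem map_prodAssoc_compProd_prodMkLeft {X Y Z : Type*} [MeasurableSpace X]
    [MeasurableSpace Y] [MeasurableSpace Z] (μ : Measure X) [SFinite μ] (ν : Measure Y) [SFinite ν]
    (ξ : Kernel Y Z) [IsSFiniteKernel ξ] :
    ((μ.prod ν) ⊗ₘ (Kernel.prodMkLeft X ξ)).map MeasurableEquiv.prodAssoc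
      = μ.prod (ν ⊗ₘ ξ) := by
  refine Measure.ext_of_lintegral _ fun f hf => ?_
  have hfm : Measurable fun p : (X × Y) × Z => f (MeasurableEquiv.prodAssoc p) :=
    hf.comp MeasurableEquiv.prodAssoc.measurable
  rw [lintegral_map hf MeasurableEquiv.prodAssoc.measurable,
    Measure.lintegral_compProd hfm, lintegral_prod _ hf.aemeasurable, lintegral_prod]
  · refine lintegral_congr fun x => ?_
    rw [Measure.lintegral_compProd (by fun_prop)]
    rfl
  · exact hfm.lintegral_kernel_prod_right'.aemeasurable

section

variable {X Z : Type*} [MeasurableSpace X] [MeasurableSpace Z] {lam : Measure Z}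
  [IsProbabilityMeasure lam] {θ : X → Z → ℝ} {k : X → X → ℝ} {π : Measure (X × X)}
  {μ ν : Measure X} [IsProbabilityMeasure μ]

theorem IsLatentFactorization.llr_latentLift (h : IsLatentFactorization lam θ k)
    [IsProbabilityMeasure π] {g : (X × X) × Z → ℝ≥0∞} (hg : Measurable g)
    [IsFiniteMeasure ((π.prod lam).withDensity g)]
    (hac : latentLift lam θ k π ≪ (π.prod lam).withDensity g) :
    ∀ᵐ p ∂(latentLift lam θ k π), llr (latentLift lam θ k π) ((π.prod lam).withDensity g) p
      = θ p.1.1 p.2 + θ p.1.2 p.2 + k p.1.1 p.1.2 - Real.log (g p).toReal := by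
  have hγ : IsProbabilityMeasure (latentLift lam θ k π) := h.isProbabilityMeasure_latentLift
  rw [latentLift] at hγ hac ⊢
  filter_upwards [llr_withDensity_withDensity (π.prod lam) h.measurable_latentDensity hg hac]
    with p hp
  rw [hp, ENNReal.toReal_ofReal (Real.exp_pos _).le, Real.log_exp]

open InformationTheory in
/-- Data processing: forgetting the second endpoint does not increase the mutual information of the
first endpoint with the rest. -/
theorem IsLatentFactorization.klDiv_latentLift_map_fst_le (h : IsLatentFactorization lam θ k)
    [IsProbabilityMeasure π] :
    klDiv ((latentLift lam θ k π).map fun p => (p.1.1, p.2))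
        (μ.prod (latentLift lam θ k π).snd)
      ≤ klDiv ((latentLift lam θ k π).map MeasurableEquiv.prodAssoc)
        (μ.prod ((latentLift lam θ k π).map fun p => (p.1.2, p.2))) := by
  have hγ : IsProbabilityMeasure (latentLift lam θ k π) := h.isProbabilityMeasure_latentLift
  have hg : Measurable fun p : X × X × Z => (p.1, p.2.2) := by fun_prop
  have hq : Measurable fun p : (X × X) × Z => (p.1.2, p.2) := by fun_prop
  have := klDiv_map_le ((latentLift lam θ k π).map MeasurableEquiv.prodAssoc)
    (μ.prod ((latentLift lam θ k π).map fun p => (p.1.2, p.2))) hg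
  have e1 : ((latentLift lam θ k π).map MeasurableEquiv.prodAssoc).map
      (fun p : X × X × Z => (p.1, p.2.2)) = (latentLift lam θ k π).map fun p => (p.1.1, p.2) := by
    rw [Measure.map_map hg MeasurableEquiv.prodAssoc.measurable]
    rfl
  have e2 : (μ.prod ((latentLift lam θ k π).map fun p => (p.1.2, p.2))).map
      (fun p : X × X × Z => (p.1, p.2.2)) = μ.prod (latentLift lam θ k π).snd := by
    have := Measure.map_prod_map μ ((latentLift lam θ k π).map fun p => (p.1.2, p.2))
      measurable_id (measurable_snd (α := X) (β := Z))
    rw [Measure.map_id, Measure.map_map measurable_snd hq] at this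
    exact this.symm
  rwa [e1, e2] at this

variable [IsProbabilityMeasure ν] [StandardBorelSpace X] [Nonempty X]

open InformationTheory in
/-- Under the lift of a coupling `π` of finite entropy, the first endpoint has finite mutual
information with the pair of the second endpoint and the latent variable. The reference measure
used for this draws the latent variable from its conditional law given the pair `(y, y)`; the
resulting log-density `θ x - θ y + k x y - k y y` is integrable. -/
theorem IsLatentFactorization.klDiv_latentLift_prod_ne_top (h : IsLatentFactorization lam θ k)
    (hπ : π ∈ couplings μ ν) (hkl : klDiv π (μ.prod ν) ≠ ⊤)
    (hk : Integrable (fun q => k q.1 q.2) π) (hd₁ : Integrable (fun x => k x x) μ)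
    (hd₂ : Integrable (fun x => k x x) ν) :
    klDiv ((latentLift lam θ k π).map MeasurableEquiv.prodAssoc)
      (μ.prod ((latentLift lam θ k π).map fun p => (p.1.2, p.2))) ≠ ⊤ := by
  have := isProbabilityMeasure_of_mem_couplings hπ
  have hγ : IsProbabilityMeasure (latentLift lam θ k π) := h.isProbabilityMeasure_latentLift
  have hD := h.integrable_factor_sub hk (integrable_comp_fst_of_mem_couplings hπ hd₁)
    (integrable_comp_snd_of_mem_couplings hπ hd₂)
  have hkγ : ∀ {f : X × X → ℝ}, Integrable f π →
      Integrable (fun p => f p.1) (latentLift lam θ k π) := fun hf =>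
    Integrable.comp_measurable (by rwa [← Measure.fst, h.fst_latentLift]) measurable_fst
  -- the conditional laws of the latent variable given `(x, y)` and given `(y, y)`, as kernels
  let r : X × X → Z → ℝ≥0∞ := fun q z =>
    ENNReal.ofReal (Real.exp (θ q.1 z + θ q.2 z + k q.1 q.2))
  have hr : Measurable (Function.uncurry r) := h.measurable_latentDensity
  let s : X → Z → ℝ≥0∞ := fun y z => r (y, y) z
  have hs : Measurable (Function.uncurry s) := by
    change Measurable ((Function.uncurry r) ∘ fun p : X × Z => ((p.1, p.1), p.2))
    exact hr.comp (by fun_prop)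
  let κ : Kernel (X × X) Z := (Kernel.const (X × X) lam).withDensity r
  let ξ : Kernel X Z := (Kernel.const X lam).withDensity s
  have hκ : IsMarkovKernel κ := ⟨fun q => ⟨by
    rw [Kernel.withDensity_apply' _ hr, setLIntegral_univ]
    exact h.lintegral_exp_add q.1 q.2⟩⟩
  have hξ : IsMarkovKernel ξ := ⟨fun y => ⟨by
    rw [Kernel.withDensity_apply' _ hs, setLIntegral_univ]
    exact h.lintegral_exp_add y y⟩⟩
  have eκ : latentLift lam θ k π = π ⊗ₘ κ := by
    rw [Measure.compProd_withDensity hr, Measure.compProd_const]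
    rfl
  let s' : (X × X) × Z → ℝ≥0∞ := fun p => s p.1.2 p.2
  have hs' : Measurable s' := hs.comp (by fun_prop : Measurable
    fun p : (X × X) × Z => (p.1.2, p.2))
  have eξ : π ⊗ₘ Kernel.prodMkLeft X ξ = (π.prod lam).withDensity s' := by
    have hk' : Kernel.prodMkLeft X ξ
        = (Kernel.const (X × X) lam).withDensity fun q z => s q.2 z := by
      refine Kernel.ext fun q => ?_
      rw [Kernel.prodMkLeft_apply, Kernel.withDensity_apply _ hs, Kernel.withDensity_apply _ hs']
      rfl
    have : IsMarkovKernel ((Kernel.const (X × X) lam).withDensity fun q z => s q.2 z) := by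
      rw [← hk']; infer_instance
    rw [hk', Measure.compProd_withDensity hs', Measure.compProd_const]
  have hfin : IsFiniteMeasure ((π.prod lam).withDensity s') := by rw [← eξ]; infer_instance
  have hac : latentLift lam θ k π ≪ (π.prod lam).withDensity s' := by
    refine (withDensity_absolutelyContinuous _ _).trans
      (withDensity_absolutelyContinuous' hs'.aemeasurable (ae_of_all _ fun p => ?_))
    exact (ENNReal.ofReal_pos.2 (Real.exp_pos _)).ne'
  have k1 : klDiv (latentLift lam θ k π) ((π.prod lam).withDensity s') ≠ ⊤ := by
    refine klDiv_ne_top hac ?_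
    refine ((hD.add (hkγ hk)).sub (hkγ (integrable_comp_snd_of_mem_couplings hπ hd₂))).congr ?_
    filter_upwards [h.llr_latentLift hs' hac] with p hp
    rw [hp]
    simp only [s', s, r, Pi.add_apply, Pi.sub_apply, ENNReal.toReal_ofReal (Real.exp_pos _).le,
      Real.log_exp]
    ring
  have k2 : klDiv (latentLift lam θ k π) ((μ.prod ν) ⊗ₘ Kernel.prodMkLeft X ξ) ≠ ⊤ := by
    rw [eκ, klDiv_compProd_eq_add, eξ, ← eκ]
    exact ENNReal.add_ne_top.2 ⟨hkl, k1⟩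
  rw [← klDiv_map_measurableEquiv MeasurableEquiv.prodAssoc,
    map_prodAssoc_compProd_prodMkLeft] at k2
  have hp : IsProbabilityMeasure ((latentLift lam θ k π).map MeasurableEquiv.prodAssoc) :=
    Measure.isProbabilityMeasure_map MeasurableEquiv.prodAssoc.measurable.aemeasurable
  rw [klDiv_prod_eq_add_snd] at k2
  have e3 : ((latentLift lam θ k π).map MeasurableEquiv.prodAssoc).snd
      = (latentLift lam θ k π).map fun p => (p.1.2, p.2) := by
    rw [Measure.snd, Measure.map_map measurable_snd MeasurableEquiv.prodAssoc.measurable]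
    rfl
  rw [← e3]
  exact (ENNReal.add_ne_top.1 k2).2

variable [StandardBorelSpace Z] [Nonempty Z]

open InformationTheory in
/-- A coupling of finite entropic cost lifts to a pair of latent couplings with a common latent
marginal, whose total latent cost is at most the entropic cost of the coupling. -/
theorem IsLatentFactorization.latent_cost_le (h : IsLatentFactorization lam θ k)
    (hπ : π ∈ couplings μ ν) (hkl : klDiv π (μ.prod ν) ≠ ⊤)
    (hk : Integrable (fun q => k q.1 q.2) π) (hd₁ : Integrable (fun x => k x x) μ)
    (hd₂ : Integrable (fun x => k x x) ν)
    {η : Measure Z} (hη : η = (latentLift lam θ k π).snd)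
    {π₁ π₂ : Measure (X × Z)} (h₁ : π₁ = (latentLift lam θ k π).map fun p => (p.1.1, p.2))
    (h₂ : π₂ = (latentLift lam θ k π).map fun p => (p.1.2, p.2)) :
    IsProbabilityMeasure η ∧ η ≪ lam ∧ π₁ ∈ couplings μ η ∧ π₂ ∈ couplings ν η ∧
      klDiv π₁ (μ.prod η) ≠ ⊤ ∧ klDiv π₂ (ν.prod η) ≠ ⊤ ∧
      Integrable (fun p => θ p.1 p.2 - llr η lam p.2 / 2) π₁ ∧
      Integrable (fun p => θ p.1 p.2 - llr η lam p.2 / 2) π₂ ∧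
      ((klDiv π₁ (μ.prod η)).toReal - ∫ p, (θ p.1 p.2 - llr η lam p.2 / 2) ∂π₁)
          + ((klDiv π₂ (ν.prod η)).toReal - ∫ p, (θ p.1 p.2 - llr η lam p.2 / 2) ∂π₂)
        ≤ ∫ q, k q.1 q.2 ∂π + (klDiv π (μ.prod ν)).toReal := by
  have hπp := isProbabilityMeasure_of_mem_couplings hπ
  have hγ : IsProbabilityMeasure (latentLift lam θ k π) := h.isProbabilityMeasure_latentLift
  have q₁ : Measurable fun p : (X × X) × Z => (p.1.1, p.2) := by fun_prop
  have q₂ : Measurable fun p : (X × X) × Z => (p.1.2, p.2) := by fun_prop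
  have hηp : IsProbabilityMeasure η := by rw [hη]; infer_instance
  have hηac : η ≪ lam := by rw [hη]; exact snd_latentLift_absolutelyContinuous
  have hfst := h.fst_latentLift (π := π)
  have c₁ : π₁ ∈ couplings μ η := by
    refine ⟨?_, ?_⟩
    · rw [h₁, Measure.map_map measurable_fst q₁, ← hπ.1]
      conv_rhs => rw [← hfst]
      rw [Measure.fst, Measure.map_map measurable_fst measurable_fst]
      rfl
    · rw [h₁, hη, Measure.map_map measurable_snd q₁]
      rfl
  have c₂ : π₂ ∈ couplings ν η := by
    refine ⟨?_, ?_⟩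
    · rw [h₂, Measure.map_map measurable_fst q₂, ← hπ.2]
      conv_rhs => rw [← hfst]
      rw [Measure.fst, Measure.map_map measurable_snd measurable_fst]
      rfl
    · rw [h₂, hη, Measure.map_map measurable_snd q₂]
      rfl
  -- finiteness of the mutual informations between each endpoint and the latent variable
  have f₁ := h.klDiv_latentLift_prod_ne_top hπ hkl hk hd₁ hd₂
  have le₁ : klDiv π₁ (μ.prod η) ≤ klDiv ((latentLift lam θ k π).map MeasurableEquiv.prodAssoc)
      (μ.prod π₂) := by
    rw [h₁, h₂, hη]; exact h.klDiv_latentLift_map_fst_le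
  rw [← h₂] at f₁
  have kl₁ : klDiv π₁ (μ.prod η) ≠ ⊤ := ne_top_of_le_ne_top f₁ le₁
  have kl₂ : klDiv π₂ (ν.prod η) ≠ ⊤ := by
    have hπ' := map_swap_mem_couplings hπ
    have hkl' : klDiv (π.map Prod.swap) (ν.prod μ) ≠ ⊤ := by
      rw [← Measure.prod_swap]
      exact (klDiv_map_measurableEquiv MeasurableEquiv.prodComm π (μ.prod ν)).trans_ne hkl
    have hk' : Integrable (fun q => k q.1 q.2) (π.map Prod.swap) := by
      refine (integrable_map_measure h.measurable_cost.aestronglyMeasurable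
        measurable_swap.aemeasurable).2 (hk.congr (ae_of_all _ fun q => ?_))
      exact h.symm _ _
    have := isProbabilityMeasure_of_mem_couplings hπ'
    have f₂ := h.klDiv_latentLift_prod_ne_top hπ' hkl' hk' hd₂ hd₁
    have le₂ := h.klDiv_latentLift_map_fst_le (π := π.map Prod.swap) (μ := ν)
    have hm : Measurable fun p : (X × X) × Z => ((p.1.2, p.1.1), p.2) := by fun_prop
    have e₁ : (latentLift lam θ k (π.map Prod.swap)).map (fun p => (p.1.1, p.2)) = π₂ := by
      rw [h.latentLift_map_swap, Measure.map_map q₁ hm, h₂]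
      rfl
    have e₂ : (latentLift lam θ k (π.map Prod.swap)).snd = η := by
      rw [h.latentLift_map_swap, Measure.snd, Measure.map_map measurable_snd hm, hη]
      rfl
    rw [e₁, e₂] at le₂
    exact ne_top_of_le_ne_top f₂ le₂
  -- two ways of applying the chain rule to the entropy relative to `(μ ⊗ ν) ⊗ η`
  have hassoc : IsProbabilityMeasure ((latentLift lam θ k π).map MeasurableEquiv.prodAssoc) :=
    Measure.isProbabilityMeasure_map MeasurableEquiv.prodAssoc.measurable.aemeasurable
  have chain₁ := klDiv_prod_eq_add_fst (latentLift lam θ k π) (μ.prod ν) η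
  have chain₂ := klDiv_prod_eq_add_snd
    ((latentLift lam θ k π).map MeasurableEquiv.prodAssoc) μ (ν.prod η)
  have e3 : ((latentLift lam θ k π).map MeasurableEquiv.prodAssoc).snd = π₂ := by
    rw [Measure.snd, Measure.map_map measurable_snd MeasurableEquiv.prodAssoc.measurable, h₂]
    rfl
  rw [e3, ← Measure.prodAssoc_prod, klDiv_map_measurableEquiv, chain₁, hfst] at chain₂
  have hfinite : klDiv π₂ (ν.prod η)
      + klDiv ((latentLift lam θ k π).map MeasurableEquiv.prodAssoc) (μ.prod π₂) ≠ ⊤ :=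
    ENNReal.add_ne_top.2 ⟨kl₂, f₁⟩
  have klγ : klDiv (latentLift lam θ k π) (π.prod η) ≠ ⊤ := by
    rw [← chain₂] at hfinite
    exact (ENNReal.add_ne_top.1 hfinite).2
  have hle : (klDiv π₁ (μ.prod η)).toReal + (klDiv π₂ (ν.prod η)).toReal
      ≤ (klDiv π (μ.prod ν)).toReal + (klDiv (latentLift lam θ k π) (π.prod η)).toReal := by
    rw [← ENNReal.toReal_add kl₁ kl₂, ← ENNReal.toReal_add hkl klγ, chain₂, add_comm]
    exact ENNReal.toReal_mono hfinite (by gcongr)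
  -- the log-density of the lift relative to `π ⊗ η`
  have hθ := h.measurable_factor
  have hll : Measurable (llr η lam) := measurable_llr η lam
  obtain ⟨hac, hint⟩ := klDiv_ne_top_iff.1 klγ
  have hdens : Measurable fun p : (X × X) × Z => η.rnDeriv lam p.2 :=
    (Measure.measurable_rnDeriv η lam).comp measurable_snd
  have eη : π.prod η = (π.prod lam).withDensity fun p => η.rnDeriv lam p.2 := by
    refine Measure.ext_of_lintegral _ fun f hf => ?_
    rw [lintegral_withDensity_eq_lintegral_mul _ hdens hf, lintegral_prod _ hf.aemeasurable,
      lintegral_prod _ (hdens.mul hf).aemeasurable]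
    refine lintegral_congr fun q => ?_
    exact (lintegral_rnDeriv_mul hηac (by fun_prop)).symm
  have hllr : ∀ᵐ p ∂(latentLift lam θ k π), llr (latentLift lam θ k π) (π.prod η) p
      = θ p.1.1 p.2 + θ p.1.2 p.2 + k p.1.1 p.1.2 - llr η lam p.2 := by
    have : IsFiniteMeasure ((π.prod lam).withDensity fun p => η.rnDeriv lam p.2) := by
      rw [← eη]; infer_instance
    rw [eη] at hac ⊢
    exact h.llr_latentLift hdens hac
  have hD := h.integrable_factor_sub hk (integrable_comp_fst_of_mem_couplings hπ hd₁)
    (integrable_comp_snd_of_mem_couplings hπ hd₂)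
  have hkγ : Integrable (fun p : (X × X) × Z => k p.1.1 p.1.2) (latentLift lam θ k π) := by
    rw [← hfst] at hk
    exact hk.comp_measurable measurable_fst
  have B₁ : Integrable (fun p : (X × X) × Z => θ p.1.1 p.2 - llr η lam p.2 / 2)
      (latentLift lam θ k π) := by
    refine (((hint.sub hkγ).add hD).div_const 2).congr ?_
    filter_upwards [hllr] with p hp
    simp only [Pi.add_apply, Pi.sub_apply, hp]
    ring
  have B₂ : Integrable (fun p : (X × X) × Z => θ p.1.2 p.2 - llr η lam p.2 / 2)
      (latentLift lam θ k π) := by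
    refine (B₁.sub hD).congr (ae_of_all _ fun p => ?_)
    simp only [Pi.sub_apply]
    ring
  have hmeas : Measurable fun p : X × Z => θ p.1 p.2 - llr η lam p.2 / 2 :=
    hθ.sub ((hll.comp measurable_snd).div_const 2)
  have A₁ : Integrable (fun p => θ p.1 p.2 - llr η lam p.2 / 2) π₁ := by
    rw [h₁]
    exact (integrable_map_measure hmeas.aestronglyMeasurable q₁.aemeasurable).2 B₁
  have A₂ : Integrable (fun p => θ p.1 p.2 - llr η lam p.2 / 2) π₂ := by
    rw [h₂]
    exact (integrable_map_measure hmeas.aestronglyMeasurable q₂.aemeasurable).2 B₂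
  refine ⟨hηp, hηac, c₁, c₂, kl₁, kl₂, A₁, A₂, ?_⟩
  have I₁ : ∫ p, (θ p.1 p.2 - llr η lam p.2 / 2) ∂π₁
      = ∫ p, (θ p.1.1 p.2 - llr η lam p.2 / 2) ∂(latentLift lam θ k π) := by
    rw [h₁]
    exact integral_map q₁.aemeasurable hmeas.aestronglyMeasurable
  have I₂ : ∫ p, (θ p.1 p.2 - llr η lam p.2 / 2) ∂π₂
      = ∫ p, (θ p.1.2 p.2 - llr η lam p.2 / 2) ∂(latentLift lam θ k π) := by
    rw [h₂]
    exact integral_map q₂.aemeasurable hmeas.aestronglyMeasurable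
  have Ik : ∫ q, k q.1 q.2 ∂π = ∫ p, k p.1.1 p.1.2 ∂(latentLift lam θ k π) := by
    conv_lhs => rw [← hfst]
    exact integral_map measurable_fst.aemeasurable h.measurable_cost.aestronglyMeasurable
  have Il : (klDiv (latentLift lam θ k π) (π.prod η)).toReal
      = ∫ p, (θ p.1.1 p.2 - llr η lam p.2 / 2) ∂(latentLift lam θ k π)
        + ∫ p, (θ p.1.2 p.2 - llr η lam p.2 / 2) ∂(latentLift lam θ k π)
        + ∫ p, k p.1.1 p.1.2 ∂(latentLift lam θ k π) := by
    rw [toReal_klDiv_of_measure_eq hac (by simp)]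
    refine Eq.trans ?_ ((integral_add (B₁.add B₂) hkγ).trans
      (congrArg (· + _) (integral_add B₁ B₂)))
    refine integral_congr_ae ?_
    filter_upwards [hllr] with p hp
    simp only [Pi.add_apply, hp]
    ring
  rw [I₁, I₂, Ik]
  linarith

end

/-! ### Gaussian series -/

/-- The random series `∑ i, v i * z i`, as the limit of its partial sums. Where the partial sums do
not converge, which for square-summable `v` is a `gaussianSeq`-null event, the value is arbitrary
but fixed. -/
noncomputable def gaussianSeries (v : ℕ → ℝ) (z : ℕ → ℝ) : ℝ :=
  limUnder atTop fun n => ∑ i ∈ Finset.range n, v i * z i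

instance isProbabilityMeasure_gaussianSeq : IsProbabilityMeasure gaussianSeq := by
  unfold gaussianSeq; infer_instance

theorem iIndepFun_mul_gaussianSeq (v : ℕ → ℝ) :
    iIndepFun (fun (i : ℕ) (z : ℕ → ℝ) => v i * z i) gaussianSeq :=
  iIndepFun_infinitePi (P := fun _ : ℕ => gaussianReal 0 1) (X := fun i x => v i * x)
    fun _ => measurable_const_mul _

theorem map_mul_gaussianSeq (v : ℕ → ℝ) (i : ℕ) :
    gaussianSeq.map (fun z => v i * z i) = gaussianReal 0 (Real.toNNReal (v i ^ 2)) := by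
  have h1 : gaussianSeq.map (fun z : ℕ → ℝ => z i) = gaussianReal 0 1 :=
    Measure.infinitePi_map_eval (fun _ : ℕ => gaussianReal 0 1) i
  have h2 := gaussianReal_map_const_mul (μ := 0) (v := 1) (v i)
  have h3 := Measure.map_map (μ := gaussianSeq) (g := fun x : ℝ => v i * x)
    (f := fun z : ℕ → ℝ => z i) (by fun_prop) (by fun_prop)
  rw [← h1, h3] at h2
  refine h2.trans ?_
  congr 1
  · simp
  · rw [mul_one]
    exact NNReal.eq (Real.coe_toNNReal _ (sq_nonneg _)).symm

theorem map_sum_gaussianSeq (v : ℕ → ℝ) (n : ℕ) :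
    gaussianSeq.map (∑ i ∈ Finset.range n, fun z => v i * z i)
      = gaussianReal 0 (∑ i ∈ Finset.range n, Real.toNNReal (v i ^ 2)) := by
  induction n with
  | zero =>
    have e : (∑ i ∈ Finset.range 0, fun z : ℕ → ℝ => v i * z i) = fun _ => (0 : ℝ) := by
      funext z; simp
    rw [e, Measure.map_const]
    simp
  | succ n ih =>
    have hind : IndepFun (∑ i ∈ Finset.range n, fun z : ℕ → ℝ => v i * z i)
        (fun z => v n * z n) gaussianSeq :=
      (iIndepFun_mul_gaussianSeq v).indepFun_finsetSum_of_notMem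
        (fun i => (measurable_pi_apply i).const_mul _) Finset.notMem_range_self
    rw [Finset.sum_range_succ, Finset.sum_range_succ,
      gaussianReal_add_gaussianReal_of_indepFun hind ih (map_mul_gaussianSeq v n), add_zero]

theorem lintegral_exp_of_map_gaussianReal {Ω : Type*} [MeasurableSpace Ω] {P : Measure Ω}
    {f : Ω → ℝ} {s : NNReal} (hf : Measurable f) (h : P.map f = gaussianReal 0 s) :
    ∫⁻ ω, ENNReal.ofReal (Real.exp (f ω)) ∂P = ENNReal.ofReal (Real.exp (s / 2)) := by
  have hm := mgf_gaussianReal (X := id) (p := gaussianReal 0 s) (μ := 0) (v := s) (by simp) 1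
  have hi := integrable_exp_mul_gaussianReal (μ := 0) (v := s) 1
  simp only [mgf, id, one_mul, zero_add, one_pow, mul_one] at hm hi
  rw [← hm, ofReal_integral_eq_lintegral_ofReal hi (ae_of_all _ fun x => (Real.exp_pos x).le),
    ← h, lintegral_map (by fun_prop) hf]

theorem lintegral_exp_sum_gaussianSeq (v : ℕ → ℝ) (n : ℕ) :
    ∫⁻ z, ENNReal.ofReal (Real.exp (∑ i ∈ Finset.range n, v i * z i)) ∂gaussianSeq
      = ENNReal.ofReal (Real.exp ((∑ i ∈ Finset.range n, v i ^ 2) / 2)) := by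
  have hm : Measurable (∑ i ∈ Finset.range n, fun z : ℕ → ℝ => v i * z i) := by
    have e : (∑ i ∈ Finset.range n, fun z : ℕ → ℝ => v i * z i)
        = fun z => ∑ i ∈ Finset.range n, v i * z i := by
      funext z; simp
    rw [e]
    exact Finset.measurable_fun_sum _ fun i _ => (measurable_pi_apply i).const_mul _
  have h := lintegral_exp_of_map_gaussianReal hm (map_sum_gaussianSeq v n)
  simp only [Finset.sum_apply, NNReal.coe_sum, Real.coe_toNNReal _ (sq_nonneg _)] at h
  exact h

theorem hasSum_sq_lp (v : lp (fun _ : ℕ => ℝ) 2) : HasSum (fun i => v i ^ 2) (‖v‖ ^ 2) := by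
  have h := lp.hasSum_norm (p := 2) (by norm_num) v
  simpa using h

/-- A Gaussian series with square-summable coefficients converges almost surely, as an
`L¹`-bounded martingale. -/
theorem ae_tendsto_gaussianSeries (v : lp (fun _ : ℕ => ℝ) 2) :
    ∀ᵐ z ∂gaussianSeq, Tendsto (fun n => ∑ i ∈ Finset.range n, v i * z i) atTop
      (𝓝 (gaussianSeries v z)) := by
  let u : ℕ → (ℕ → ℝ) → ℝ := fun i z => v i * z i
  have hu : ∀ i, StronglyMeasurable (u i) := fun i =>
    ((measurable_pi_apply i).const_mul _).stronglyMeasurable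
  have hind : iIndepFun u gaussianSeq := iIndepFun_mul_gaussianSeq v
  have hmap (i : ℕ) : gaussianSeq.map (u i) = gaussianReal 0 (Real.toNNReal (v i ^ 2)) :=
    map_mul_gaussianSeq v i
  have hint (i : ℕ) : Integrable (u i) gaussianSeq := by
    have h1 : Integrable id (gaussianSeq.map (u i)) := by
      rw [hmap]; exact (memLp_id_gaussianReal 1).integrable le_rfl
    exact h1.comp_measurable (hu i).measurable
  have hmean (i : ℕ) : ∫ z, u i z ∂gaussianSeq = 0 := by
    have h1 : ∫ x, id x ∂(gaussianSeq.map (u i)) = 0 := by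
      rw [hmap]; exact integral_id_gaussianReal
    rwa [integral_map (hu i).measurable.aemeasurable aestronglyMeasurable_id] at h1
  let ℱ := Filtration.natural u hu
  let M : ℕ → (ℕ → ℝ) → ℝ := fun n => ∑ i ∈ Finset.range (n + 1), u i
  have hmart : Martingale M ℱ gaussianSeq := by
    refine martingale_of_condExp_sub_eq_zero_nat (fun n => ?_) (fun n => ?_) fun n => ?_
    · refine Finset.stronglyMeasurable_sum _ fun i hi => ?_
      exact ((Filtration.stronglyAdapted_natural hu) i).mono
        (ℱ.mono (Nat.lt_succ_iff.1 (Finset.mem_range.1 hi)))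
    · exact integrable_finsetSum' _ fun i _ => hint i
    · have e : M (n + 1) - M n = u (n + 1) := by
        simp only [M]
        rw [Finset.sum_range_succ _ (n + 1)]
        simp
      rw [e]
      refine (hind.condExp_natural_ae_eq_of_lt hu (Nat.lt_succ_self n)).trans ?_
      rw [hmean]
      rfl
  have hle (w : ℕ → ℝ) (hw : ∀ i, w i ^ 2 = v i ^ 2) (n : ℕ) :
      ∫⁻ z, ENNReal.ofReal (Real.exp (∑ i ∈ Finset.range n, w i * z i)) ∂gaussianSeq
        ≤ ENNReal.ofReal (Real.exp (‖v‖ ^ 2 / 2)) := by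
    rw [lintegral_exp_sum_gaussianSeq]
    refine ENNReal.ofReal_le_ofReal (Real.exp_le_exp.2 ?_)
    simp only [hw]
    have := (hasSum_sq_lp v).summable.sum_le_tsum (Finset.range n) fun i _ => sq_nonneg (v i)
    rw [(hasSum_sq_lp v).tsum_eq] at this
    linarith
  have hbdd (n : ℕ) : eLpNorm (M n) 1 gaussianSeq
      ≤ (2 * Real.toNNReal (Real.exp (‖v‖ ^ 2 / 2)) : NNReal) := by
    rw [eLpNorm_one_eq_lintegral_enorm]
    calc ∫⁻ z, ‖M n z‖ₑ ∂gaussianSeq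
        ≤ ∫⁻ z, (ENNReal.ofReal (Real.exp (∑ i ∈ Finset.range (n + 1), v i * z i))
          + ENNReal.ofReal (Real.exp (∑ i ∈ Finset.range (n + 1), (-v i) * z i)))
            ∂gaussianSeq := by
          refine lintegral_mono fun z => ?_
          rw [Real.enorm_eq_ofReal_abs,
            ← ENNReal.ofReal_add (Real.exp_pos _).le (Real.exp_pos _).le]
          refine ENNReal.ofReal_le_ofReal ?_
          have eM : M n z = ∑ i ∈ Finset.range (n + 1), v i * z i := by
            simp [M, u, Finset.sum_apply]
          simp only [neg_mul, Finset.sum_neg_distrib]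
          rw [eM]
          set t := ∑ i ∈ Finset.range (n + 1), v i * z i
          have h1 := Real.add_one_le_exp t
          have h2 := Real.add_one_le_exp (-t)
          have h3 := Real.exp_pos t
          have h4 := Real.exp_pos (-t)
          exact abs_le.2 ⟨by linarith, by linarith⟩
      _ ≤ ENNReal.ofReal (Real.exp (‖v‖ ^ 2 / 2)) + ENNReal.ofReal (Real.exp (‖v‖ ^ 2 / 2)) := by
          rw [lintegral_add_left (by fun_prop)]
          exact add_le_add (hle v (fun _ => rfl) _) (hle (fun i => -v i) (fun i => neg_sq _) _)
      _ = (2 * Real.toNNReal (Real.exp (‖v‖ ^ 2 / 2)) : NNReal) := by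
          rw [← two_mul, ENNReal.coe_mul]
          rfl
  filter_upwards [hmart.submartingale.ae_tendsto_limitProcess hbdd] with z hz
  refine tendsto_nhds_limUnder ⟨_, (tendsto_add_atTop_iff_nat 1).1 (hz.congr fun n => ?_)⟩
  simp [M, u, Finset.sum_apply]

theorem measurable_gaussianSeries_comp {X : Type*} [MeasurableSpace X] {φ : X → ℕ → ℝ}
    (hφ : ∀ i, Measurable fun x => φ x i) :
    Measurable fun p : X × (ℕ → ℝ) => gaussianSeries (φ p.1) p.2 := by
  refine (StronglyMeasurable.limUnder fun n => ?_).measurable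
  refine Measurable.stronglyMeasurable (Finset.measurable_fun_sum _ fun i _ => ?_)
  exact ((hφ i).comp measurable_fst).mul ((measurable_pi_apply i).comp measurable_snd)

theorem measurable_gaussianSeries (v : ℕ → ℝ) : Measurable (gaussianSeries v) := by
  refine (StronglyMeasurable.limUnder fun n => ?_).measurable
  refine Measurable.stronglyMeasurable (Finset.measurable_fun_sum _ fun i _ => ?_)
  exact (measurable_pi_apply i).const_mul _

/-- The law of a Gaussian series is the centred Gaussian law with the expected variance. -/
theorem map_gaussianSeries (v : lp (fun _ : ℕ => ℝ) 2) :
    gaussianSeq.map (gaussianSeries v) = gaussianReal 0 (Real.toNNReal (‖v‖ ^ 2)) := by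
  have hS := measurable_gaussianSeries v
  have := Measure.isProbabilityMeasure_map (μ := gaussianSeq) hS.aemeasurable
  refine Measure.ext_of_charFun (funext fun t => ?_)
  have hm (n : ℕ) : Measurable fun z : ℕ → ℝ => ∑ i ∈ Finset.range n, v i * z i :=
    Finset.measurable_fun_sum _ fun i _ => (measurable_pi_apply i).const_mul _
  have l1 : Tendsto (fun n => ∫ z, Complex.exp (t * (∑ i ∈ Finset.range n, v i * z i : ℝ)
      * Complex.I) ∂gaussianSeq) atTop
      (𝓝 (∫ z, Complex.exp (t * (gaussianSeries v z : ℝ) * Complex.I) ∂gaussianSeq)) := by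
    refine tendsto_integral_of_dominated_convergence (fun _ => 1) (fun n => ?_)
      (integrable_const 1) (fun n => ae_of_all _ fun z => ?_) ?_
    · have := hm n
      exact Measurable.aestronglyMeasurable (by fun_prop)
    · rw [← Complex.ofReal_mul, Complex.norm_exp_ofReal_mul_I]
    · filter_upwards [ae_tendsto_gaussianSeries v] with z hz
      have hcont : Continuous fun x : ℝ => Complex.exp (t * (x : ℂ) * Complex.I) := by fun_prop
      exact (hcont.tendsto _).comp hz
  have e1 : charFun (gaussianSeq.map (gaussianSeries v)) t
      = ∫ z, Complex.exp (t * (gaussianSeries v z : ℝ) * Complex.I) ∂gaussianSeq := by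
    rw [charFun_apply_real, integral_map hS.aemeasurable
      (Measurable.aestronglyMeasurable (by fun_prop))]
  have e2 (n : ℕ) : ∫ z, Complex.exp (t * (∑ i ∈ Finset.range n, v i * z i : ℝ)
      * Complex.I) ∂gaussianSeq
      = Complex.exp (-(∑ i ∈ Finset.range n, v i ^ 2 : ℝ) * t ^ 2 / 2) := by
    have h1 := congrArg (fun m => charFun m t) (map_sum_gaussianSeq v n)
    have h2 : (∑ i ∈ Finset.range n, fun z : ℕ → ℝ => v i * z i)
        = fun z => ∑ i ∈ Finset.range n, v i * z i := by
      funext z; simp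
    simp only [charFun_gaussianReal, h2] at h1
    rw [charFun_apply_real, integral_map (hm n).aemeasurable
      (Measurable.aestronglyMeasurable (by fun_prop))] at h1
    rw [h1, NNReal.coe_sum]
    simp only [Real.coe_toNNReal _ (sq_nonneg _)]
    congr 1
    push_cast
    ring
  have l2 : Tendsto (fun n => Complex.exp (-(∑ i ∈ Finset.range n, v i ^ 2 : ℝ) * t ^ 2 / 2))
      atTop (𝓝 (Complex.exp (-(‖v‖ ^ 2 : ℝ) * t ^ 2 / 2))) := by
    have hcont : Continuous fun x : ℝ => Complex.exp (-(x : ℂ) * t ^ 2 / 2) := by fun_prop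
    exact (hcont.tendsto _).comp (hasSum_sq_lp v).tendsto_sum_nat
  simp_rw [e2] at l1
  rw [e1, tendsto_nhds_unique l1 l2, charFun_gaussianReal, Real.coe_toNNReal _ (sq_nonneg _)]
  congr 1
  push_cast
  ring

theorem lintegral_exp_gaussianSeries (v : lp (fun _ : ℕ => ℝ) 2) :
    ∫⁻ z, ENNReal.ofReal (Real.exp (gaussianSeries v z)) ∂gaussianSeq
      = ENNReal.ofReal (Real.exp (‖v‖ ^ 2 / 2)) := by
  rw [lintegral_exp_of_map_gaussianReal (measurable_gaussianSeries v) (map_gaussianSeries v),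
    Real.coe_toNNReal _ (sq_nonneg _)]

theorem gaussianSeries_linear_ae (a b : ℝ) (u v : lp (fun _ : ℕ => ℝ) 2) :
    ∀ᵐ z ∂gaussianSeq, gaussianSeries (a • u + b • v : lp (fun _ : ℕ => ℝ) 2) z
      = a * gaussianSeries u z + b * gaussianSeries v z := by
  filter_upwards [ae_tendsto_gaussianSeries u, ae_tendsto_gaussianSeries v,
    ae_tendsto_gaussianSeries (a • u + b • v)] with z hu hv huv
  refine tendsto_nhds_unique huv (((hu.const_mul a).add (hv.const_mul b)).congr fun n => ?_)
  rw [Finset.mul_sum, Finset.mul_sum, ← Finset.sum_add_distrib]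
  refine Finset.sum_congr rfl fun i _ => ?_
  simp only [lp.coeFn_add, lp.coeFn_smul, Pi.add_apply, Pi.smul_apply, smul_eq_mul]
  ring

/-! ### Feature maps of negative definite costs -/

/-- An orthonormal family in a separable inner product space is countable: the balls of radius
`1 / 2` around its members are disjoint. -/
theorem countable_of_orthonormal {E ι : Type*} [NormedAddCommGroup E] [InnerProductSpace ℝ E]
    [TopologicalSpace.SeparableSpace E] {b : ι → E} (hb : Orthonormal ℝ b) : Countable ι := by
  refine Pairwise.countable_of_isOpen_disjoint (s := fun i => Metric.ball (b i) (1 / 2))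
    (fun i j hij => ?_) (fun i => Metric.isOpen_ball)
    fun i => ⟨b i, Metric.mem_ball_self (by norm_num)⟩
  refine Metric.ball_disjoint_ball ?_
  have h1 : dist (b i) (b j) ^ 2 = 2 := by
    rw [dist_eq_norm, norm_sub_sq_real, hb.2 hij, hb.1, hb.1]
    norm_num
  nlinarith [dist_nonneg (x := b i) (y := b j)]

/-- Every separable Hilbert space embeds isometrically in `ℓ²(ℕ)`. -/
theorem exists_linearIsometry_lp (E : Type*) [NormedAddCommGroup E] [InnerProductSpace ℝ E]
    [CompleteSpace E] [TopologicalSpace.SeparableSpace E] :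
    Nonempty (E →ₗᵢ[ℝ] lp (fun _ : ℕ => ℝ) 2) := by
  obtain ⟨w, b, -⟩ := exists_hilbertBasis ℝ E
  have hw : Countable w := countable_of_orthonormal b.orthonormal
  obtain ⟨e, he⟩ := exists_injective_nat w
  let s : HilbertBasis ℕ ℝ (lp (fun _ : ℕ => ℝ) 2) := HilbertBasis.ofRepr (LinearIsometryEquiv.refl ℝ _)
  have hs : Orthonormal ℝ (fun i => s (e i)) := s.orthonormal.comp e he
  exact ⟨hs.orthogonalFamily.linearIsometry.comp b.repr.toLinearIsometry⟩

/-- The double sum of a negative definite cost over a finite family whose weights need not sum to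
zero, after subtraction of the affine terms at a base point. -/
theorem NegativeDefiniteCost.sum_centered_nonneg {X : Type*} {c : X → X → ℝ}
    (hneg : NegativeDefiniteCost c) (o : X) {N : ℕ} (x : Fin N → X) (a : Fin N → ℝ) :
    0 ≤ ∑ i, ∑ j, a i * a j * (c (x i) o + c (x j) o - c (x i) (x j) - c o o) := by
  -- the base point receives the weight that makes the total weight vanish
  have h := hneg.2 (N + 1) (Fin.cons o x) (Fin.cons (-∑ i, a i) a) (by simp [Fin.sum_univ_succ])
  simp only [Fin.sum_univ_succ, Fin.cons_zero, Fin.cons_succ] at h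
  have hs (j : Fin N) : c o (x j) = c (x j) o := hneg.1 _ _
  simp only [hs] at h
  have e : ∑ i, ∑ j, a i * a j * (c (x i) o + c (x j) o - c (x i) (x j) - c o o)
      = 2 * ((∑ i, a i) * ∑ i, a i * c (x i) o) - (∑ i, ∑ j, a i * a j * c (x i) (x j))
        - (∑ i, a i) * (∑ i, a i) * c o o := by
    have e1 : (∑ i, a i) * ∑ i, a i * c (x i) o = ∑ i, ∑ j, a i * a j * c (x i) o := by
      rw [Finset.sum_mul_sum, Finset.sum_comm]
      exact Finset.sum_congr rfl fun i _ => Finset.sum_congr rfl fun j _ => by ring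
    have e2 : (∑ i, a i) * ∑ i, a i * c (x i) o = ∑ i, ∑ j, a i * a j * c (x j) o := by
      rw [Finset.sum_mul_sum]
      exact Finset.sum_congr rfl fun i _ => Finset.sum_congr rfl fun j _ => by ring
    have e3 : (∑ i, a i) * (∑ i, a i) * c o o = ∑ i, ∑ j, a i * a j * c o o := by
      rw [Finset.sum_mul_sum, Finset.sum_mul]
      exact Finset.sum_congr rfl fun i _ => by rw [Finset.sum_mul]
    rw [two_mul, e3]
    nth_rewrite 1 [e1]
    rw [e2, ← Finset.sum_add_distrib, ← Finset.sum_sub_distrib, ← Finset.sum_sub_distrib]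
    refine Finset.sum_congr rfl fun i _ => ?_
    rw [← Finset.sum_add_distrib, ← Finset.sum_sub_distrib, ← Finset.sum_sub_distrib]
    exact Finset.sum_congr rfl fun j _ => by ring
  have e4 (A : ℝ) : ∑ i, (a i * -A) * c (x i) o = -(A * ∑ i, a i * c (x i) o) := by
    rw [Finset.mul_sum, ← Finset.sum_neg_distrib]
    exact Finset.sum_congr rfl fun i _ => by ring
  have e5 (A : ℝ) : ∑ i, (-A) * a i * c (x i) o = -(A * ∑ i, a i * c (x i) o) := by
    rw [Finset.mul_sum, ← Finset.sum_neg_distrib]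
    exact Finset.sum_congr rfl fun i _ => by ring
  rw [Finset.sum_add_distrib, e4, e5] at h
  rw [e]
  nlinarith [h]

universe u in
/-- A positive semidefinite real kernel is the Gram kernel of a map to a Hilbert space. -/
theorem exists_gram_map {X : Type u} (K : X → X → ℝ) (hsymm : ∀ x y, K x y = K y x)
    (hpos : ∀ (N : ℕ) (x : Fin N → X) (a : Fin N → ℝ), 0 ≤ ∑ i, ∑ j, a i * a j * K (x i) (x j)) :
    ∃ (H : Type u) (_ : NormedAddCommGroup H) (_ : InnerProductSpace ℝ H) (_ : CompleteSpace H)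
      (Φ : X → H), ∀ x y, inner ℝ (Φ x) (Φ y) = K x y := by
  let M : Matrix X X (ℝ →L[ℝ] ℝ) := .of fun x y => K x y • ContinuousLinearMap.id ℝ ℝ
  have hM : M.PosSemidef := by
    have key := (RKHS.posSemidef_tfae (K := M)).out 0 2
    refine key.mpr ⟨?_, fun f => ?_⟩
    · refine Matrix.IsHermitian.ext fun x y => ?_
      simp only [M, Matrix.of_apply, star_smul, hsymm y x]
      congr 1
      exact star_one (ℝ →L[ℝ] ℝ)
    · let e := f.support.equivFin
      have h := hpos f.support.card (fun i => (e.symm i : X)) fun i => f (e.symm i)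
      have e1 (g : X → ℝ) : ∑ i, g (e.symm i : X) = ∑ x ∈ f.support, g x := by
        rw [← Finset.sum_coe_sort f.support]
        exact Equiv.sum_comp e.symm fun x : f.support => g x
      have e2 : ∑ i, ∑ j, f (e.symm i) * f (e.symm j) * K (e.symm i) (e.symm j)
          = ∑ x ∈ f.support, ∑ y ∈ f.support, f x * f y * K x y := by
        rw [← e1 fun x => ∑ y ∈ f.support, f x * f y * K x y]
        exact Finset.sum_congr rfl fun i _ => e1 fun y => f (e.symm i) * f y * K (e.symm i) y
      rw [e2] at h
      refine h.trans (le_of_eq ?_)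
      simp only [Finsupp.sum, M, Matrix.of_apply, RCLike.re_to_real]
      refine Finset.sum_congr rfl fun x _ => Finset.sum_congr rfl fun y _ => ?_
      simp [hsymm y x]
      ring
  have : Fact M.PosSemidef := ⟨hM⟩
  refine ⟨RKHS.OfKernel M, inferInstance, inferInstance, inferInstance,
    fun x => RKHS.kerFun (RKHS.OfKernel M) x 1, fun x y => ?_⟩
  rw [← RKHS.kernel_inner, RKHS.OfKernel.kernel_ofKernel]
  simp [M, hsymm y x]

/-- Schoenberg's embedding: a continuous negative definite cost is, up to diagonal terms, a squared
distance between feature vectors in `ℓ²`. -/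
theorem NegativeDefiniteCost.exists_featureMap {X : Type*} [TopologicalSpace X]
    [TopologicalSpace.SeparableSpace X] {c : X → X → ℝ}
    (hc : Continuous fun p : X × X => c p.1 p.2) (hneg : NegativeDefiniteCost c) :
    ∃ φ : X → lp (fun _ : ℕ => ℝ) 2, Continuous φ ∧
      ∀ x y, c x y = ‖φ x - φ y‖ ^ 2 + c x x / 2 + c y y / 2 := by
  rcases isEmpty_or_nonempty X with hX | ⟨⟨o⟩⟩
  · exact ⟨fun x => hX.elim x, continuous_of_const fun x => hX.elim x, fun x => hX.elim x⟩
  obtain ⟨H, _, _, _, Φ, hΦ⟩ := exists_gram_map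
    (fun x y => (c x o + c y o - c x y - c o o) / 2)
    (fun x y => by rw [hneg.1 x y]; ring)
    (fun N x a => by
      have h := hneg.sum_centered_nonneg o x a
      have e : ∑ i, ∑ j, a i * a j * ((c (x i) o + c (x j) o - c (x i) (x j) - c o o) / 2)
          = (∑ i, ∑ j, a i * a j * (c (x i) o + c (x j) o - c (x i) (x j) - c o o)) / 2 := by
        rw [Finset.sum_div]
        refine Finset.sum_congr rfl fun i _ => ?_
        rw [Finset.sum_div]
        exact Finset.sum_congr rfl fun j _ => by ring
      rw [e]
      linarith)
  have hdist (x y : X) : ‖Φ x - Φ y‖ ^ 2 = c x y - c x x / 2 - c y y / 2 := by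
    rw [norm_sub_sq_real, hΦ, ← real_inner_self_eq_norm_sq, ← real_inner_self_eq_norm_sq, hΦ, hΦ]
    ring
  have hcont : Continuous Φ := by
    refine continuous_iff_continuousAt.2 fun x => ?_
    rw [ContinuousAt, tendsto_iff_norm_sub_tendsto_zero]
    have h1 : Continuous fun y => √(c y x - c y y / 2 - c x x / 2) := by
      have a1 : Continuous fun y => c y x := hc.comp (by fun_prop : Continuous fun y => (y, x))
      have a2 : Continuous fun y => c y y := hc.comp (by fun_prop : Continuous fun y => (y, y))
      fun_prop
    have h2 := h1.tendsto x
    have h3 : √(c x x - c x x / 2 - c x x / 2) = 0 := by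
      rw [Real.sqrt_eq_zero']; linarith
    rw [h3] at h2
    refine h2.congr fun y => ?_
    rw [← hdist, Real.sqrt_sq (norm_nonneg _)]
  let V : Submodule ℝ H := (Submodule.span ℝ (Set.range Φ)).topologicalClosure
  have hsep : TopologicalSpace.SeparableSpace V := by
    refine TopologicalSpace.IsSeparable.separableSpace ?_
    exact (TopologicalSpace.isSeparable_range hcont).span.closure
  have hcomp : CompleteSpace V :=
    (Submodule.isClosed_topologicalClosure _).completeSpace_coe
  have hmem (x : X) : Φ x ∈ V :=
    Submodule.le_topologicalClosure _ (Submodule.subset_span ⟨x, rfl⟩)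
  obtain ⟨T⟩ := exists_linearIsometry_lp V
  refine ⟨fun x => T ⟨Φ x, hmem x⟩, T.continuous.comp (hcont.subtype_mk hmem), fun x y => ?_⟩
  rw [← map_sub, T.norm_map, Submodule.coe_norm]
  change c x y = ‖Φ x - Φ y‖ ^ 2 + c x x / 2 + c y y / 2
  rw [hdist]
  ring

/-! ### Extended-real bookkeeping for the entropic cost -/

theorem upperAdd_mono {a b a' b' : EReal} (ha : a ≤ a') (hb : b ≤ b') :
    upperAdd a b ≤ upperAdd a' b' :=
  EReal.neg_le_neg_iff.2 (add_le_add (EReal.neg_le_neg_iff.2 ha) (EReal.neg_le_neg_iff.2 hb))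

/-- Bounds through real upper approximations of `x` and `y` pass to `x + y + κ`; when `x` or `y` is
`-∞` they force `t = -∞`. -/
theorem le_upperAdd_of_forall_lt {t x y : EReal} {κ : ℝ} (hx : x ≠ ⊤) (hy : y ≠ ⊤)
    (h : ∀ a b : ℝ, x < a → y < b → t ≤ ((a + b + κ : ℝ) : EReal)) :
    t ≤ upperAdd (upperAdd x y) κ := by
  have hbot (h' : ∀ r : ℝ, t ≤ (r : EReal)) : t = ⊥ :=
    (EReal.eq_bot_iff_forall_lt t).2 fun r =>
      (h' (r - 1)).trans_lt (EReal.coe_lt_coe_iff.2 (by linarith))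
  induction x with
  | top => exact absurd rfl hx
  | bot =>
    obtain ⟨b, hb⟩ : ∃ b : ℝ, y < b := by
      obtain ⟨b, hb, -⟩ := EReal.lt_iff_exists_real_btwn.1 (lt_top_iff_ne_top.2 hy)
      exact ⟨b, hb⟩
    rw [hbot fun r => ?_]
    · exact bot_le
    · have := h (r - b - κ) b (EReal.bot_lt_coe _) hb
      rwa [show r - b - κ + b + κ = r by ring] at this
  | coe x =>
    induction y with
    | top => exact absurd rfl hy
    | bot =>
      rw [hbot fun r => ?_]
      · exact bot_le
      · have := h (x + 1) (r - (x + 1) - κ) (EReal.coe_lt_coe_iff.2 (by linarith))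
          (EReal.bot_lt_coe _)
        rwa [show x + 1 + (r - (x + 1) - κ) + κ = r by ring] at this
    | coe y =>
      rw [upperAdd_coe, upperAdd_coe]
      refine EReal.le_of_forall_lt_iff_le.1 fun r hr => ?_
      rw [EReal.coe_lt_coe_iff] at hr
      have := h (x + (r - (x + y + κ)) / 2) (y + (r - (x + y + κ)) / 2)
        (EReal.coe_lt_coe_iff.2 (by linarith)) (EReal.coe_lt_coe_iff.2 (by linarith))
      rwa [show x + (r - (x + y + κ)) / 2 + (y + (r - (x + y + κ)) / 2) + κ = r by ring] at this

theorem coe_ofReal_mul_ennreal {ε : ℝ} (hε : 0 ≤ ε) {a : ℝ≥0∞} (ha : a ≠ ⊤) :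
    ((ENNReal.ofReal ε * a : ℝ≥0∞) : EReal) = ((ε * a.toReal : ℝ) : EReal) := by
  conv_lhs => rw [← ENNReal.ofReal_toReal ha, ← ENNReal.ofReal_mul hε]
  rw [EReal.coe_ennreal_ofReal, max_eq_left (mul_nonneg hε ENNReal.toReal_nonneg)]

theorem coe_ofReal_mul_top {ε : ℝ} (hε : 0 < ε) :
    ((ENNReal.ofReal ε * ⊤ : ℝ≥0∞) : EReal) = ⊤ := by
  rw [ENNReal.mul_top (ENNReal.ofReal_pos.2 hε).ne', EReal.coe_ennreal_top]

theorem extIntegral_of_integrable {Ω : Type*} [MeasurableSpace Ω] {π : Measure Ω} {f : Ω → ℝ}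
    (hf : Integrable f π) : extIntegral f π = ((∫ ω, f ω ∂π : ℝ) : EReal) := by
  have h1 : ∫⁻ ω, ENNReal.ofReal (f ω) ∂π ≠ ⊤ := by
    refine ne_top_of_le_ne_top hf.hasFiniteIntegral.ne (lintegral_mono fun ω => ?_)
    rw [Real.enorm_eq_ofReal_abs]
    exact ENNReal.ofReal_le_ofReal (le_abs_self _)
  have h2 : ∫⁻ ω, ENNReal.ofReal (-f ω) ∂π ≠ ⊤ := by
    refine ne_top_of_le_ne_top hf.hasFiniteIntegral.ne (lintegral_mono fun ω => ?_)
    rw [Real.enorm_eq_ofReal_abs]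
    exact ENNReal.ofReal_le_ofReal (neg_le_abs _)
  rw [extIntegral, integral_eq_lintegral_pos_part_sub_lintegral_neg_part hf,
    ← EReal.coe_toReal (x := ((∫⁻ ω, ENNReal.ofReal (f ω) ∂π : ℝ≥0∞) : EReal)) (by simpa) (by simp),
    ← EReal.coe_toReal (x := ((∫⁻ ω, ENNReal.ofReal (-f ω) ∂π : ℝ≥0∞) : EReal)) (by simpa)
      (by simp), ← EReal.coe_neg, upperAdd_coe, EReal.toReal_coe_ennreal, EReal.toReal_coe_ennreal,
    sub_eq_add_neg]

theorem integrable_of_extIntegral_ne_top {Ω : Type*} [MeasurableSpace Ω] {π : Measure Ω}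
    {f : Ω → ℝ} (hf : Measurable f) (hneg : Integrable (fun ω => max (-f ω) 0) π)
    (htop : extIntegral f π ≠ ⊤) : Integrable f π := by
  have h1 : ∫⁻ ω, ENNReal.ofReal (f ω) ∂π ≠ ⊤ := by
    intro h
    rw [extIntegral, h, EReal.coe_ennreal_top, top_upperAdd] at htop
    exact htop rfl
  have hpos : Integrable (fun ω => max (f ω) 0) π := by
    refine ⟨(hf.max measurable_const).aestronglyMeasurable,
      (hasFiniteIntegral_iff_ofReal (f := fun ω => max (f ω) 0)
        (ae_of_all _ fun ω => le_max_right _ _)).2 ?_⟩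
    refine lt_top_iff_ne_top.2 (ne_of_eq_of_ne (lintegral_congr fun ω => ?_) h1)
    rcases le_total (f ω) 0 with h | h
    · rw [max_eq_right h, ENNReal.ofReal_zero, ENNReal.ofReal_of_nonpos h]
    · rw [max_eq_left h]
  refine (hpos.sub hneg).congr (ae_of_all _ fun ω => ?_)
  simp only [Pi.sub_apply]
  rcases le_total (f ω) 0 with h | h
  · rw [max_eq_right h, max_eq_left (neg_nonneg.2 h)]; ring
  · rw [max_eq_left h, max_eq_right (neg_nonpos.2 h)]; ring

section

variable {X Y : Type*} [MeasurableSpace X] [MeasurableSpace Y] {ε : ℝ} {f : X → Y → ℝ}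
  {μ : Measure X} {ν : Measure Y}

theorem entropicOT_le_of_mem_couplings (hε : 0 < ε) {π : Measure (X × Y)} (hπ : π ∈ couplings μ ν)
    (hf : Integrable (fun p => f p.1 p.2) π)
    (hkl : InformationTheory.klDiv π (μ.prod ν) ≠ ⊤) :
    entropicOT ε f μ ν ≤ ((∫ p, f p.1 p.2 ∂π
      + ε * (InformationTheory.klDiv π (μ.prod ν)).toReal : ℝ) : EReal) := by
  refine (iInf₂_le π hπ).trans_eq ?_
  rw [extIntegral_of_integrable hf, coe_ofReal_mul_ennreal hε.le hkl, upperAdd_coe]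

/-- If the negative part of the cost is integrable for the couplings of finite entropy, a real upper
bound on the entropic cost is witnessed by a coupling along which all terms are finite. -/
theorem exists_coupling_of_entropicOT_lt (hε : 0 < ε)
    (hf : Measurable fun p : X × Y => f p.1 p.2)
    (hneg : ∀ π ∈ couplings μ ν, InformationTheory.klDiv π (μ.prod ν) ≠ ⊤ →
      Integrable (fun p => max (-f p.1 p.2) 0) π) {a : ℝ} (ha : entropicOT ε f μ ν < a) :
    ∃ π ∈ couplings μ ν, Integrable (fun p => f p.1 p.2) π ∧
      InformationTheory.klDiv π (μ.prod ν) ≠ ⊤ ∧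
      ∫ p, f p.1 p.2 ∂π + ε * (InformationTheory.klDiv π (μ.prod ν)).toReal < a := by
  simp only [entropicOT, iInf_lt_iff] at ha
  obtain ⟨π, hπ, hlt⟩ := ha
  have hkl : InformationTheory.klDiv π (μ.prod ν) ≠ ⊤ := by
    intro h
    rw [h, coe_ofReal_mul_top hε, upperAdd_top] at hlt
    exact not_top_lt hlt
  have hint : Integrable (fun p => f p.1 p.2) π := by
    refine integrable_of_extIntegral_ne_top hf (hneg π hπ hkl) fun h => ?_
    rw [h, top_upperAdd] at hlt
    exact not_top_lt hlt
  refine ⟨π, hπ, hint, hkl, ?_⟩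
  rwa [extIntegral_of_integrable hint, coe_ofReal_mul_ennreal hε.le hkl, upperAdd_coe,
    EReal.coe_lt_coe_iff] at hlt

theorem entropicOT_ne_bot (hε : 0 < ε) (hf : Measurable fun p : X × Y => f p.1 p.2) {B : ℝ}
    (hneg : ∀ π ∈ couplings μ ν, Integrable (fun p => max (-f p.1 p.2) 0) π ∧
      ∫ p, max (-f p.1 p.2) 0 ∂π ≤ B) : entropicOT ε f μ ν ≠ ⊥ := by
  intro h
  obtain ⟨π, hπ, hint, -, hlt⟩ := exists_coupling_of_entropicOT_lt (a := -B) hε hf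
    (fun π hπ _ => (hneg π hπ).1) (by rw [h]; exact EReal.bot_lt_coe _)
  have h1 : -∫ p, max (-f p.1 p.2) 0 ∂π ≤ ∫ p, f p.1 p.2 ∂π := by
    rw [← integral_neg]
    refine integral_mono (hneg π hπ).1.neg hint fun p => ?_
    have := le_max_left (-f p.1 p.2) 0
    simp only
    linarith
  have h2 : 0 ≤ ε * (InformationTheory.klDiv π (μ.prod ν)).toReal :=
    mul_nonneg hε.le ENNReal.toReal_nonneg
  have h3 := (hneg π hπ).2
  linarith

end

theorem entropicOT_comm {X : Type*} [MeasurableSpace X] (ε : ℝ) {c : X → X → ℝ}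
    (hc : Measurable fun p : X × X => c p.1 p.2) (hsymm : ∀ x y, c x y = c y x) (μ ν : Measure X)
    [IsProbabilityMeasure μ] [IsProbabilityMeasure ν] :
    entropicOT ε c μ ν = entropicOT ε c ν μ := by
  have key (μ ν : Measure X) [IsProbabilityMeasure μ] [IsProbabilityMeasure ν] :
      entropicOT ε c μ ν ≤ entropicOT ε c ν μ := by
    refine le_iInf₂ fun π hπ => (iInf₂_le _ (map_swap_mem_couplings hπ)).trans_eq ?_
    have := isProbabilityMeasure_of_mem_couplings hπ
    have e1 : InformationTheory.klDiv (π.map Prod.swap) (μ.prod ν)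
        = InformationTheory.klDiv π (ν.prod μ) := by
      rw [← Measure.prod_swap]
      exact klDiv_map_measurableEquiv MeasurableEquiv.prodComm π (ν.prod μ)
    have e2 : extIntegral (fun p : X × X => c p.1 p.2) (π.map Prod.swap)
        = extIntegral (fun p : X × X => c p.1 p.2) π := by
      rw [extIntegral, extIntegral, lintegral_map (by fun_prop) measurable_swap,
        lintegral_map (by fun_prop) measurable_swap]
      simp only [Prod.fst_swap, Prod.snd_swap, hsymm]
    rw [e1, e2]
  exact le_antisymm (key μ ν) (key ν μ)

/-! ### Entropic transport for latent factorizations -/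

section

variable {X Z : Type*} [MeasurableSpace X] [MeasurableSpace Z] {lam : Measure Z}
  {θ : X → Z → ℝ} {k : X → X → ℝ}

theorem IsLatentFactorization.lintegral_exp_diag (h : IsLatentFactorization lam θ k) (x : X) :
    ∫⁻ z, ENNReal.ofReal (Real.exp (2 * (θ x z + k x x / 2))) ∂lam = 1 := by
  rw [← h.lintegral_exp_add x x]
  exact lintegral_congr fun z => by congr 2; ring

/-- `exp (a + b) ≤ (exp (2 a) + exp (2 b)) / 2`, integrated. -/
theorem lintegral_exp_add_le_one {a b : Z → ℝ} (ha : Measurable a)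
    (h₁ : ∫⁻ z, ENNReal.ofReal (Real.exp (2 * a z)) ∂lam = 1)
    (h₂ : ∫⁻ z, ENNReal.ofReal (Real.exp (2 * b z)) ∂lam = 1) :
    ∫⁻ z, ENNReal.ofReal (Real.exp (a z + b z)) ∂lam ≤ 1 := by
  have key (z : Z) : ENNReal.ofReal (Real.exp (a z + b z))
      ≤ 2⁻¹ * (ENNReal.ofReal (Real.exp (2 * a z)) + ENNReal.ofReal (Real.exp (2 * b z))) := by
    have e : (2⁻¹ : ℝ≥0∞) = ENNReal.ofReal 2⁻¹ := by
      rw [ENNReal.ofReal_inv_of_pos two_pos]; simp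
    rw [e, ← ENNReal.ofReal_add (Real.exp_pos _).le (Real.exp_pos _).le,
      ← ENNReal.ofReal_mul (by norm_num)]
    refine ENNReal.ofReal_le_ofReal ?_
    rw [Real.exp_add, two_mul, two_mul, Real.exp_add, Real.exp_add]
    nlinarith [sq_nonneg (Real.exp (a z) - Real.exp (b z))]
  refine (lintegral_mono key).trans ?_
  rw [lintegral_const_mul' _ _ (by simp), lintegral_add_left (by fun_prop), h₁, h₂,
    one_add_one_eq_two, ENNReal.inv_mul_cancel (by simp) (by simp)]

/-- The factor `exp (θ x ·)` has `lam`-mean at most `exp (-k x x / 2)`. -/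
theorem IsLatentFactorization.lintegral_exp_factor_le [IsProbabilityMeasure lam]
    (h : IsLatentFactorization lam θ k) (x : X) :
    ∫⁻ z, ENNReal.ofReal (Real.exp (θ x z + k x x / 2)) ∂lam ≤ 1 := by
  have hx : Measurable (θ x) := h.measurable_factor.comp measurable_prodMk_left
  have := lintegral_exp_add_le_one (lam := lam) (b := fun _ => 0) (hx.add_const (k x x / 2))
    (h.lintegral_exp_diag x) (by simp)
  simpa using this

/-- A cost with a latent factorization dominates the mean of its diagonal values. -/
theorem IsLatentFactorization.half_diag_le (h : IsLatentFactorization lam θ k) (x y : X) :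
    k x x / 2 + k y y / 2 ≤ k x y := by
  have hx : Measurable (θ x) := h.measurable_factor.comp measurable_prodMk_left
  have hy : Measurable (θ y) := h.measurable_factor.comp measurable_prodMk_left
  have h1 := lintegral_exp_add_le_one (lam := lam) (hx.add_const (k x x / 2))
    (h.lintegral_exp_diag x) (h.lintegral_exp_diag y)
  have h2 : ∫⁻ z, ENNReal.ofReal (Real.exp (θ x z + k x x / 2 + (θ y z + k y y / 2))) ∂lam
      = ENNReal.ofReal (Real.exp (k x x / 2 + k y y / 2 - k x y)) := by
    have e (z : Z) : ENNReal.ofReal (Real.exp (θ x z + k x x / 2 + (θ y z + k y y / 2)))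
        = ENNReal.ofReal (Real.exp (θ x z + θ y z))
          * ENNReal.ofReal (Real.exp (k x x / 2 + k y y / 2)) := by
      rw [← ENNReal.ofReal_mul (Real.exp_pos _).le, ← Real.exp_add]
      congr 2; ring
    simp_rw [e]
    rw [lintegral_mul_const _ (by fun_prop), h.lintegral_exp,
      ← ENNReal.ofReal_mul (Real.exp_pos _).le, ← Real.exp_add]
    congr 2; ring
  rw [h2, ← ENNReal.ofReal_one, ENNReal.ofReal_le_ofReal_iff zero_le_one,
    Real.exp_le_one_iff] at h1
  linarith

end

theorem integral_half_llr_comp_snd {X Z : Type*} [MeasurableSpace X] [MeasurableSpace Z]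
    {lam : Measure Z} [IsProbabilityMeasure lam] {η : Measure Z} [IsProbabilityMeasure η]
    (hac : η ≪ lam) {π : Measure (X × Z)} {ρ : Measure X} (hπ : π ∈ couplings ρ η) :
    ∫ p, llr η lam p.2 / 2 ∂π = (InformationTheory.klDiv η lam).toReal / 2 := by
  have h1 := integral_map (μ := π) measurable_snd.aemeasurable
    (f := llr η lam) (measurable_llr η lam).aestronglyMeasurable
  rw [hπ.2] at h1
  rw [InformationTheory.toReal_klDiv_of_measure_eq hac (by simp), integral_div, h1]

theorem max_neg_le_of_half_diag_le {X : Type*} {c : X → X → ℝ}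
    (hdiag : ∀ x y, c x x / 2 + c y y / 2 ≤ c x y) (x y : X) :
    max (-c x y) 0 ≤ (max (-c x x) 0 + max (-c y y) 0) / 2 := by
  have h1 := le_max_left (-c x x) 0
  have h2 := le_max_left (-c y y) 0
  have h3 := le_max_right (-c x x) 0
  have h4 := le_max_right (-c y y) 0
  exact max_le (by linarith [hdiag x y]) (by linarith)

section

variable {X : Type*} [MeasurableSpace X] {c : X → X → ℝ} {μ ν : Measure X} {π : Measure (X × X)}

theorem integrable_negPart_of_mem_couplings (hc : Measurable fun p : X × X => c p.1 p.2)
    (hdiag : ∀ x y, c x x / 2 + c y y / 2 ≤ c x y)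
    (hμ : Integrable (fun x => max (-c x x) 0) μ) (hν : Integrable (fun x => max (-c x x) 0) ν)
    (hπ : π ∈ couplings μ ν) :
    Integrable (fun p => max (-c p.1 p.2) 0) π ∧ ∫ p, max (-c p.1 p.2) 0 ∂π
      ≤ (∫ x, max (-c x x) 0 ∂μ + ∫ x, max (-c x x) 0 ∂ν) / 2 := by
  have h1 := integrable_comp_fst_of_mem_couplings hπ hμ
  have h2 := integrable_comp_snd_of_mem_couplings hπ hν
  have h3 : Integrable (fun p => max (-c p.1 p.2) 0) π := by
    refine ((h1.add h2).div_const 2).mono' (hc.neg.max measurable_const).aestronglyMeasurable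
      (ae_of_all _ fun p => ?_)
    rw [Real.norm_of_nonneg (le_max_right _ _)]
    exact max_neg_le_of_half_diag_le hdiag p.1 p.2
  have hd : Measurable fun x => max (-c x x) 0 :=
    (hc.comp (by fun_prop : Measurable fun x : X => (x, x))).neg.max measurable_const
  have e1 : ∫ x, max (-c x x) 0 ∂μ = ∫ p, max (-c p.1 p.1) 0 ∂π := by
    conv_lhs => rw [← hπ.1]
    exact integral_map measurable_fst.aemeasurable hd.aestronglyMeasurable
  have e2 : ∫ x, max (-c x x) 0 ∂ν = ∫ p, max (-c p.2 p.2) 0 ∂π := by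
    conv_lhs => rw [← hπ.2]
    exact integral_map measurable_snd.aemeasurable hd.aestronglyMeasurable
  refine ⟨h3, ?_⟩
  rw [e1, e2, ← integral_add h1 h2, ← integral_div]
  exact integral_mono h3 ((h1.add h2).div_const 2)
    fun p => max_neg_le_of_half_diag_le hdiag p.1 p.2

/-- If the cost is integrable for a coupling, then its diagonal is integrable for the marginals. -/
theorem integrable_diag_of_mem_couplings (hc : Measurable fun p : X × X => c p.1 p.2)
    (hdiag : ∀ x y, c x x / 2 + c y y / 2 ≤ c x y)
    (hμ : Integrable (fun x => max (-c x x) 0) μ) (hν : Integrable (fun x => max (-c x x) 0) ν)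
    (hπ : π ∈ couplings μ ν) (hint : Integrable (fun p => c p.1 p.2) π) :
    Integrable (fun x => c x x) μ ∧ Integrable (fun x => c x x) ν := by
  have h1 := integrable_comp_fst_of_mem_couplings hπ hμ
  have h2 := integrable_comp_snd_of_mem_couplings hπ hν
  have hd : Measurable fun x => c x x :=
    hc.comp (by fun_prop : Measurable fun x : X => (x, x))
  have hG := ((hint.abs.const_mul 2).add h1).add h2
  have key (p : X × X) : |c p.1 p.1| ≤ 2 * |c p.1 p.2| + max (-c p.1 p.1) 0 + max (-c p.2 p.2) 0
      ∧ |c p.2 p.2| ≤ 2 * |c p.1 p.2| + max (-c p.1 p.1) 0 + max (-c p.2 p.2) 0 := by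
    have h1 := le_max_left (-c p.1 p.1) 0
    have h2 := le_max_left (-c p.2 p.2) 0
    have h3 := le_max_right (-c p.1 p.1) 0
    have h4 := le_max_right (-c p.2 p.2) 0
    have h5 := le_abs_self (c p.1 p.2)
    have h6 := abs_nonneg (c p.1 p.2)
    have h7 := hdiag p.1 p.2
    exact ⟨abs_le.2 ⟨by linarith, by linarith⟩, abs_le.2 ⟨by linarith, by linarith⟩⟩
  constructor
  · rw [← hπ.1]
    refine (integrable_map_measure hd.aestronglyMeasurable measurable_fst.aemeasurable).2 ?_
    exact hG.mono' (hd.comp measurable_fst).aestronglyMeasurable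
      (ae_of_all _ fun p => (key p).1)
  · rw [← hπ.2]
    refine (integrable_map_measure hd.aestronglyMeasurable measurable_snd.aemeasurable).2 ?_
    exact hG.mono' (hd.comp measurable_snd).aestronglyMeasurable
      (ae_of_all _ fun p => (key p).2)

end

section

variable {X Z : Type*} [MeasurableSpace X] [MeasurableSpace Z] {lam : Measure Z}
  {θ : X → Z → ℝ} {c : X → X → ℝ} {ε : ℝ} {μ ν : Measure X}

theorem IsLatentFactorization.cost_half_diag_le (hε : 0 < ε)
    (h : IsLatentFactorization lam θ fun x y => c x y / ε) (x y : X) :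
    c x x / 2 + c y y / 2 ≤ c x y := by
  have := h.half_diag_le x y
  rw [div_right_comm, div_right_comm _ ε, ← add_div, div_le_div_iff_of_pos_right hε] at this
  exact this

theorem IsLatentFactorization.measurable_unscaled_cost (hε : 0 < ε)
    (h : IsLatentFactorization lam θ fun x y => c x y / ε) :
    Measurable fun p : X × X => c p.1 p.2 := by
  have := h.measurable_cost.mul_const ε
  simpa [div_mul_cancel₀ _ hε.ne'] using this

variable [IsProbabilityMeasure lam] [IsProbabilityMeasure μ]

/-- For latent couplings of finite entropy, the latent cost `-ε θ` has integrable negative part,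
by the entropy inequality for the weight `exp (θ + k x x / 2)` of mass at most one. -/
theorem IsLatentFactorization.integrable_negPart_latentCost (hε : 0 < ε)
    (h : IsLatentFactorization lam θ fun x y => c x y / ε)
    (hμ : Integrable (fun x => max (-c x x) 0) μ) {η : Measure Z} [IsProbabilityMeasure η]
    (hη : InformationTheory.klDiv η lam ≠ ⊤) {π : Measure (X × Z)} (hπ : π ∈ couplings μ η)
    (hkl : InformationTheory.klDiv π (μ.prod η) ≠ ⊤) :
    Integrable (fun p => max (-(-ε * θ p.1 p.2)) 0) π := by
  have := isProbabilityMeasure_of_mem_couplings hπ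
  obtain ⟨hac, hll⟩ := InformationTheory.klDiv_ne_top_iff.1 hη
  have hθ := h.measurable_factor
  have hc := h.measurable_unscaled_cost hε
  have hd : Measurable fun x => c x x / ε / 2 :=
    ((hc.comp (by fun_prop : Measurable fun x : X => (x, x))).div_const ε).div_const 2
  have hllm : Measurable (llr η lam) := measurable_llr η lam
  let w : X × Z → ℝ := fun p => θ p.1 p.2 + c p.1 p.1 / ε / 2 - llr η lam p.2
  have hw : Measurable w := (hθ.add (hd.comp measurable_fst)).sub (hllm.comp measurable_snd)
  have hexp : ∫⁻ p, ENNReal.ofReal (Real.exp (w p)) ∂(μ.prod η) ≤ 1 := by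
    rw [lintegral_prod _ (by fun_prop)]
    calc ∫⁻ x, ∫⁻ z, ENNReal.ofReal (Real.exp (w (x, z))) ∂η ∂μ ≤ ∫⁻ _, 1 ∂μ := by
          refine lintegral_mono fun x => ?_
          refine (lintegral_exp_sub_llr_le η lam hac (w := fun z => θ x z + c x x / ε / 2) ?_).trans
            (h.lintegral_exp_factor_le x)
          exact (hθ.comp measurable_prodMk_left).add_const _
      _ = 1 := by simp
  have hwpos := integrable_posPart_of_lintegral_exp_le π (μ.prod η) hkl hw hexp
  have h1 := integrable_comp_fst_of_mem_couplings hπ hμ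
  have h2 := integrable_comp_snd_of_mem_couplings hπ hll.abs
  refine (((hwpos.add h2).add (h1.div_const (2 * ε))).const_mul ε).mono'
    (((hθ.const_mul (-ε)).neg).max measurable_const).aestronglyMeasurable
    (ae_of_all _ fun p => ?_)
  rw [Real.norm_of_nonneg (le_max_right _ _)]
  simp only [Pi.add_apply, w]
  have a1 := le_max_left (θ p.1 p.2 + c p.1 p.1 / ε / 2 - llr η lam p.2) 0
  have a2 := le_max_right (θ p.1 p.2 + c p.1 p.1 / ε / 2 - llr η lam p.2) 0
  have a3 := le_abs_self (llr η lam p.2)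
  have a4 := abs_nonneg (llr η lam p.2)
  have a5 : -(c p.1 p.1) / (2 * ε) ≤ max (-c p.1 p.1) 0 / (2 * ε) :=
    div_le_div_of_nonneg_right (le_max_left _ _) (by positivity)
  have a6 : 0 ≤ max (-c p.1 p.1) 0 / (2 * ε) := div_nonneg (le_max_right _ _) (by positivity)
  have a7 : -(c p.1 p.1) / (2 * ε) = -(c p.1 p.1 / ε / 2) := by
    field_simp
  refine max_le ?_ (mul_nonneg hε.le (by linarith))
  rw [show -(-ε * θ p.1 p.2) = ε * θ p.1 p.2 by ring]
  exact mul_le_mul_of_nonneg_left (by linarith) hε.le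

variable [IsProbabilityMeasure ν] [StandardBorelSpace X] [Nonempty X] [StandardBorelSpace Z] [Nonempty Z]

/-- The entropic cost of `(μ, ν)` is at most the latent entropic cost through any `η`. -/
theorem IsLatentFactorization.entropicOT_le_latent (hε : 0 < ε)
    (h : IsLatentFactorization lam θ fun x y => c x y / ε)
    (hμ : Integrable (fun x => max (-c x x) 0) μ) (hν : Integrable (fun x => max (-c x x) 0) ν)
    (η : Measure Z) [IsProbabilityMeasure η] :
    entropicOT ε c μ ν ≤ upperAdd
      (upperAdd (entropicOT ε (fun x z => -ε * θ x z) μ η)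
        (entropicOT ε (fun x z => -ε * θ x z) ν η))
      ((ENNReal.ofReal ε * InformationTheory.klDiv η lam : ℝ≥0∞) : EReal) := by
  by_cases hη : InformationTheory.klDiv η lam = ⊤
  · rw [hη, coe_ofReal_mul_top hε, upperAdd_top]
    exact le_top
  by_cases t₁ : entropicOT ε (fun x z => -ε * θ x z) μ η = ⊤
  · rw [t₁, top_upperAdd, top_upperAdd]
    exact le_top
  by_cases t₂ : entropicOT ε (fun x z => -ε * θ x z) ν η = ⊤
  · rw [t₂, upperAdd_top, top_upperAdd]
    exact le_top
  rw [coe_ofReal_mul_ennreal hε.le hη]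
  refine le_upperAdd_of_forall_lt t₁ t₂ fun a b ha hb => ?_
  have hψ : Measurable fun p : X × Z => -ε * θ p.1 p.2 := h.measurable_factor.const_mul _
  obtain ⟨π₁, c₁, i₁, kl₁, l₁⟩ := exists_coupling_of_entropicOT_lt hε hψ
    (fun π hπ hkl => h.integrable_negPart_latentCost hε hμ hη hπ hkl) ha
  obtain ⟨π₂, c₂, i₂, kl₂, l₂⟩ := exists_coupling_of_entropicOT_lt hε hψ
    (fun π hπ hkl => h.integrable_negPart_latentCost hε hν hη hπ hkl) hb
  obtain ⟨hac, hll⟩ := InformationTheory.klDiv_ne_top_iff.1 hη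
  have hθi {π : Measure (X × Z)} (hi : Integrable (fun p => -ε * θ p.1 p.2) π) :
      Integrable (fun p => θ p.1 p.2) π := by
    refine (hi.const_mul (-ε)⁻¹).congr (ae_of_all _ fun p => ?_)
    simp only
    rw [inv_mul_cancel_left₀ (neg_ne_zero.2 hε.ne')]
  have s₁ := (integrable_comp_snd_of_mem_couplings c₁ hll).div_const 2
  have s₂ := (integrable_comp_snd_of_mem_couplings c₂ hll).div_const 2
  have hdiag := h.cost_half_diag_le hε
  have hc := h.measurable_unscaled_cost hε
  obtain ⟨π, hπ, ik, kl, hle⟩ := exists_coupling_of_latent h hac c₁ c₂ kl₁ kl₂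
    ((hθi i₁).sub s₁) ((hθi i₂).sub s₂) fun π hπ => by
      refine ((integrable_negPart_of_mem_couplings hc hdiag hμ hν hπ).1.div_const ε).congr
        (ae_of_all _ fun p => ?_)
      simp only
      rw [← max_div_div_right hε.le, zero_div, neg_div]
  have ic : Integrable (fun p => c p.1 p.2) π := by
    refine (ik.mul_const ε).congr (ae_of_all _ fun p => ?_)
    simp only
    rw [div_mul_cancel₀ _ hε.ne']
  refine (entropicOT_le_of_mem_couplings hε hπ ic kl).trans (EReal.coe_le_coe_iff.2 ?_)
  have e₁ := integral_half_llr_comp_snd hac c₁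
  have e₂ := integral_half_llr_comp_snd hac c₂
  rw [integral_sub (hθi i₁) s₁, integral_sub (hθi i₂) s₂, e₁, e₂, integral_div] at hle
  rw [integral_const_mul] at l₁ l₂
  have hmul := mul_le_mul_of_nonneg_left hle hε.le
  rw [mul_add, mul_div_cancel₀ _ hε.ne'] at hmul
  linarith

/-- Debiasing in quantitative form: every bound `a` on the entropic cost of `(μ, ν)` also bounds the
half-sum of the self-costs. A near-optimal coupling is lifted, and each of its latent couplings is
glued with itself. -/
theorem IsLatentFactorization.exists_self_costs (hε : 0 < ε)
    (h : IsLatentFactorization lam θ fun x y => c x y / ε)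
    (hμ : Integrable (fun x => max (-c x x) 0) μ) (hν : Integrable (fun x => max (-c x x) 0) ν)
    {a : ℝ} (ha : entropicOT ε c μ ν < a) :
    ∃ t₁ t₂ : ℝ, entropicOT ε c μ μ ≤ (t₁ : EReal) ∧ entropicOT ε c ν ν ≤ (t₂ : EReal) ∧
      t₁ + t₂ ≤ 2 * a := by
  have hdiag := h.cost_half_diag_le hε
  have hc := h.measurable_unscaled_cost hε
  obtain ⟨π, hπ, ic, kl, hlt⟩ := exists_coupling_of_entropicOT_lt hε hc
    (fun π hπ _ => (integrable_negPart_of_mem_couplings hc hdiag hμ hν hπ).1) ha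
  obtain ⟨d₁, d₂⟩ := integrable_diag_of_mem_couplings hc hdiag hμ hν hπ ic
  obtain ⟨hη, hac, c₁, c₂, kl₁, kl₂, A₁, A₂, hle⟩ := h.latent_cost_le hπ kl (ic.div_const ε)
    (d₁.div_const ε) (d₂.div_const ε) rfl rfl rfl
  have hself {ρ : Measure X} [IsProbabilityMeasure ρ]
      (hρ : Integrable (fun x => max (-c x x) 0) ρ) {η : Measure Z} [IsProbabilityMeasure η]
      (hac : η ≪ lam) {π₁ : Measure (X × Z)} (c₁ : π₁ ∈ couplings ρ η)
      (kl₁ : InformationTheory.klDiv π₁ (ρ.prod η) ≠ ⊤)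
      (A₁ : Integrable (fun p => θ p.1 p.2 - llr η lam p.2 / 2) π₁) :
      entropicOT ε c ρ ρ ≤ ((2 * (ε * ((InformationTheory.klDiv π₁ (ρ.prod η)).toReal
        - ∫ p, (θ p.1 p.2 - llr η lam p.2 / 2) ∂π₁)) : ℝ) : EReal) := by
    obtain ⟨π', hπ', ik, kl', hle'⟩ := exists_coupling_of_latent h hac c₁ c₁ kl₁ kl₁ A₁ A₁
      fun π hπ => by
        refine ((integrable_negPart_of_mem_couplings hc hdiag hρ hρ hπ).1.div_const ε).congr
          (ae_of_all _ fun p => ?_)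
        simp only
        rw [← max_div_div_right hε.le, zero_div, neg_div]
    have ic' : Integrable (fun p => c p.1 p.2) π' := by
      refine (ik.mul_const ε).congr (ae_of_all _ fun p => ?_)
      simp only
      rw [div_mul_cancel₀ _ hε.ne']
    refine (entropicOT_le_of_mem_couplings hε hπ' ic' kl').trans (EReal.coe_le_coe_iff.2 ?_)
    rw [integral_div] at hle'
    have hmul := mul_le_mul_of_nonneg_left hle' hε.le
    rw [mul_add, mul_div_cancel₀ _ hε.ne'] at hmul
    linarith
  refine ⟨_, _, hself hμ hac c₁ kl₁ A₁, hself hν hac c₂ kl₂ A₂, ?_⟩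
  rw [integral_div] at hle
  have hmul := mul_le_mul_of_nonneg_left hle hε.le
  rw [mul_add ε (_ / ε), mul_div_cancel₀ _ hε.ne'] at hmul
  linarith

/-- If the factors are integrable for the lift of every coupling with integrable cost, the latent
problem is not more expensive than the original one. -/
theorem IsLatentFactorization.iInf_latent_le_entropicOT (hε : 0 < ε)
    (h : IsLatentFactorization lam θ fun x y => c x y / ε)
    (hμ : Integrable (fun x => max (-c x x) 0) μ) (hν : Integrable (fun x => max (-c x x) 0) ν)
    (hθi : ∀ π ∈ couplings μ ν,
      Integrable (fun p => θ p.1.1 p.2) (latentLift lam θ (fun x y => c x y / ε) π) ∧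
      Integrable (fun p => θ p.1.2 p.2) (latentLift lam θ (fun x y => c x y / ε) π)) :
    ⨅ η : ProbabilityMeasure Z, upperAdd
      (upperAdd (entropicOT ε (fun x z => -ε * θ x z) μ η)
        (entropicOT ε (fun x z => -ε * θ x z) ν η))
      ((ENNReal.ofReal ε * InformationTheory.klDiv (η : Measure Z) lam : ℝ≥0∞) : EReal)
      ≤ entropicOT ε c μ ν := by
  have hdiag := h.cost_half_diag_le hε
  have hc := h.measurable_unscaled_cost hε
  refine EReal.le_of_forall_lt_iff_le.1 fun a ha => ?_
  obtain ⟨π, hπ, ic, kl, hlt⟩ := exists_coupling_of_entropicOT_lt hε hc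
    (fun π hπ _ => (integrable_negPart_of_mem_couplings hc hdiag hμ hν hπ).1) ha
  obtain ⟨d₁, d₂⟩ := integrable_diag_of_mem_couplings hc hdiag hμ hν hπ ic
  obtain ⟨j₁, j₂⟩ := hθi π hπ
  set γ := latentLift lam θ (fun x y => c x y / ε) π with hγ
  set η := γ.snd with hηdef
  set π₁ : Measure (X × Z) := γ.map fun p => (p.1.1, p.2) with hπ₁
  set π₂ : Measure (X × Z) := γ.map fun p => (p.1.2, p.2) with hπ₂
  obtain ⟨hη, hac, c₁, c₂, kl₁, kl₂, A₁, A₂, hle⟩ := h.latent_cost_le hπ kl (ic.div_const ε)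
    (d₁.div_const ε) (d₂.div_const ε) hηdef hπ₁ hπ₂
  have hθ := h.measurable_factor
  have q₁ : Measurable fun p : (X × X) × Z => (p.1.1, p.2) := by fun_prop
  have q₂ : Measurable fun p : (X × X) × Z => (p.1.2, p.2) := by fun_prop
  have i₁ : Integrable (fun p => θ p.1 p.2) π₁ :=
    (integrable_map_measure hθ.aestronglyMeasurable q₁.aemeasurable).2 j₁
  have i₂ : Integrable (fun p => θ p.1 p.2) π₂ :=
    (integrable_map_measure hθ.aestronglyMeasurable q₂.aemeasurable).2 j₂
  have s₁ : Integrable (fun p => llr η lam p.2 / 2) π₁ := by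
    refine (i₁.sub A₁).congr (ae_of_all _ fun p => ?_)
    simp only [Pi.sub_apply]; ring
  have s₂ : Integrable (fun p => llr η lam p.2 / 2) π₂ := by
    refine (i₂.sub A₂).congr (ae_of_all _ fun p => ?_)
    simp only [Pi.sub_apply]; ring
  have hllm : Measurable (llr η lam) := measurable_llr η lam
  have hll : Integrable (llr η lam) η := by
    have s : Integrable (fun p => llr η lam p.2) π₁ := by
      refine (s₁.const_mul 2).congr (ae_of_all _ fun p => ?_)
      simp only; ring
    have := (integrable_map_measure hllm.aestronglyMeasurable
      measurable_snd.aemeasurable (μ := π₁)).2 s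
    rwa [c₁.2] at this
  have e₁ := integral_half_llr_comp_snd hac c₁
  have e₂ := integral_half_llr_comp_snd hac c₂
  have hηkl : InformationTheory.klDiv η lam ≠ ⊤ := InformationTheory.klDiv_ne_top hac hll
  refine (iInf_le _ (⟨η, hη⟩ : ProbabilityMeasure Z)).trans ?_
  refine (upperAdd_mono (upperAdd_mono
    (entropicOT_le_of_mem_couplings hε c₁ (i₁.const_mul (-ε)) kl₁)
    (entropicOT_le_of_mem_couplings hε c₂ (i₂.const_mul (-ε)) kl₂))
    (coe_ofReal_mul_ennreal hε.le hηkl).le).trans ?_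
  rw [upperAdd_coe, upperAdd_coe, EReal.coe_le_coe_iff, integral_const_mul, integral_const_mul]
  rw [integral_sub i₁ s₁, integral_sub i₂ s₂, e₁, e₂, integral_div] at hle
  have hmul := mul_le_mul_of_nonneg_left hle hε.le
  rw [mul_add ε (_ / ε), mul_div_cancel₀ _ hε.ne'] at hmul
  linarith

end

/-- The entropic cost of a cost with a latent factorization is debiasable. -/
theorem IsLatentFactorization.debiasable {X Z : Type*} [MeasurableSpace X]
    [StandardBorelSpace X] [MeasurableSpace Z] [StandardBorelSpace Z] [Nonempty Z]
    {lam : Measure Z} [IsProbabilityMeasure lam] {θ : X → Z → ℝ} {c : X → X → ℝ} {ε : ℝ}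
    (hε : 0 < ε) (h : IsLatentFactorization lam θ fun x y => c x y / ε) :
    Debiasable (fun μ ν : AdmissibleMeasure c =>
      entropicOT ε c (μ.1 : Measure X) (ν.1 : Measure X)) := by
  have hdiag := h.cost_half_diag_le hε
  have hc := h.measurable_unscaled_cost hε
  have hsymm (x y : X) : c x y = c y x := by
    have := h.symm x y
    rwa [div_left_inj' hε.ne'] at this
  have hbot (μ ν : AdmissibleMeasure c) :
      entropicOT ε c (μ.1 : Measure X) (ν.1 : Measure X) ≠ ⊥ :=
    entropicOT_ne_bot hε hc fun π hπ =>
      integrable_negPart_of_mem_couplings hc hdiag μ.2 ν.2 hπ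
  refine ⟨fun μ ν => entropicOT_comm ε hc hsymm _ _, hbot, fun μ ν => ?_⟩
  have : Nonempty X := (μ.1 : ProbabilityMeasure X).nonempty
  have hself := fun a ha => h.exists_self_costs hε μ.2 ν.2 (a := a) ha
  have b₁ := hbot μ ν
  have b₂ := hbot μ μ
  have b₃ := hbot ν ν
  unfold debiasedCost
  simp only
  generalize entropicOT ε c (μ.1 : Measure X) (ν.1 : Measure X) = T at hself b₁ ⊢
  generalize entropicOT ε c (μ.1 : Measure X) (μ.1 : Measure X) = T₁ at hself b₂ ⊢
  generalize entropicOT ε c (ν.1 : Measure X) (ν.1 : Measure X) = T₂ at hself b₃ ⊢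
  induction T with
  | bot => exact absurd rfl b₁
  | top => rw [top_upperAdd, top_upperAdd]; exact le_top
  | coe t =>
    -- a finite cost forces both self-costs to be finite
    obtain ⟨s₁, s₂, l₁, l₂, -⟩ := hself (t + 1) (EReal.coe_lt_coe_iff.2 (by linarith))
    lift T₁ to ℝ using ⟨ne_top_of_le_ne_top (EReal.coe_ne_top _) l₁, b₂⟩
    lift T₂ to ℝ using ⟨ne_top_of_le_ne_top (EReal.coe_ne_top _) l₂, b₃⟩
    have hle : T₁ + T₂ ≤ 2 * t := by
      refine le_of_forall_pos_le_add fun δ hδ => ?_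
      obtain ⟨s₁, s₂, l₁, l₂, hs⟩ :=
        hself (t + δ / 2) (EReal.coe_lt_coe_iff.2 (by linarith))
      rw [EReal.coe_le_coe_iff] at l₁ l₂
      linarith
    rw [show (2 : EReal) = ((2 : ℝ) : EReal) from rfl, ← EReal.coe_div, ← EReal.coe_div,
      ← EReal.coe_neg, ← EReal.coe_neg, upperAdd_coe, upperAdd_coe, ← EReal.coe_zero,
      EReal.coe_le_coe_iff]
    linarith

/-! ### The Gaussian latent factorization -/

/-- The logarithm of the Gaussian factor
`exp (√(2/ε) ∑ i, φ_i(x) z_i - (2/ε) |φ(x)|² - c(x,x)/(2ε))`. -/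
noncomputable def gaussianFactor {X : Type*} (ε : ℝ) (c : X → X → ℝ)
    (φ : X → lp (fun _ : ℕ => ℝ) 2) (x : X) (z : ℕ → ℝ) : ℝ :=
  √(2 / ε) * gaussianSeries (φ x) z - 2 / ε * ‖φ x‖ ^ 2 - c x x / 2 / ε

/-- Exponential moments of linear combinations of Gaussian series. -/
theorem lintegral_exp_linear_gaussianSeries (a b t : ℝ) (u v : lp (fun _ : ℕ => ℝ) 2) :
    ∫⁻ z, ENNReal.ofReal (Real.exp (a * gaussianSeries u z + b * gaussianSeries v z + t))
      ∂gaussianSeq = ENNReal.ofReal (Real.exp (‖a • u + b • v‖ ^ 2 / 2 + t)) := by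
  have h : ∀ᵐ z ∂gaussianSeq,
      ENNReal.ofReal (Real.exp (a * gaussianSeries u z + b * gaussianSeries v z + t))
      = ENNReal.ofReal (Real.exp (gaussianSeries (a • u + b • v : lp (fun _ : ℕ => ℝ) 2) z))
        * ENNReal.ofReal (Real.exp t) := by
    filter_upwards [gaussianSeries_linear_ae a b u v] with z hz
    rw [hz, ← ENNReal.ofReal_mul (Real.exp_pos _).le, ← Real.exp_add]
  have hm := measurable_gaussianSeries (a • u + b • v : lp (fun _ : ℕ => ℝ) 2)
  rw [lintegral_congr_ae h, lintegral_mul_const _ (by fun_prop), lintegral_exp_gaussianSeries,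
    ← ENNReal.ofReal_mul (Real.exp_pos _).le, ← Real.exp_add]

theorem norm_smul_add_smul_sq (a b : ℝ) (u v : lp (fun _ : ℕ => ℝ) 2) :
    ‖a • u + b • v‖ ^ 2 = a ^ 2 * ‖u‖ ^ 2 + 2 * (a * b) * inner ℝ u v + b ^ 2 * ‖v‖ ^ 2 := by
  rw [norm_add_sq_real, norm_smul, norm_smul, real_inner_smul_left, real_inner_smul_right,
    mul_pow, mul_pow, Real.norm_eq_abs, Real.norm_eq_abs, sq_abs, sq_abs]
  ring

section

variable {X : Type*} [TopologicalSpace X] [MeasurableSpace X] [BorelSpace X]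
  {c : X → X → ℝ} {ε : ℝ} {φ : X → lp (fun _ : ℕ => ℝ) 2}

theorem measurable_gaussianFactor (hc : Continuous fun p : X × X => c p.1 p.2)
    (hφ : Continuous φ) : Measurable fun p : X × (ℕ → ℝ) => gaussianFactor ε c φ p.1 p.2 := by
  have h1 : Measurable fun p : X × (ℕ → ℝ) => gaussianSeries (φ p.1) p.2 := by
    refine measurable_gaussianSeries_comp (φ := fun x i => φ x i) fun i => ?_
    exact ((continuous_apply i).comp (lp.uniformContinuous_coe.continuous.comp hφ)).measurable
  have h2 : Measurable fun x => ‖φ x‖ ^ 2 := (hφ.norm.pow 2).measurable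
  have h3 : Measurable fun x => c x x :=
    (hc.comp (by fun_prop : Continuous fun x : X => (x, x))).measurable
  exact ((h1.const_mul _).sub ((h2.comp measurable_fst).const_mul _)).sub
    (((h3.comp measurable_fst).div_const 2).div_const ε)

theorem measurable_gaussianFactor_apply (hc : Continuous fun p : X × X => c p.1 p.2)
    (hφ : Continuous φ) (x : X) : Measurable (gaussianFactor ε c φ x) := by
  have h := (measurable_gaussianFactor (ε := ε) hc hφ).comp
    (measurable_prodMk_left : Measurable fun z : ℕ → ℝ => (x, z))
  exact h

variable [PolishSpace X]

theorem isLatentFactorization_gaussianFactor (hε : 0 < ε)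
    (hc : Continuous fun p : X × X => c p.1 p.2) (hφ : Continuous φ)
    (hcφ : ∀ x y, c x y = ‖φ x - φ y‖ ^ 2 + c x x / 2 + c y y / 2) :
    IsLatentFactorization gaussianSeq (gaussianFactor ε c φ) fun x y => c x y / ε where
  measurable_factor := measurable_gaussianFactor hc hφ
  measurable_cost := hc.measurable.div_const ε
  lintegral_exp x y := by
    have e (z : ℕ → ℝ) : gaussianFactor ε c φ x z + gaussianFactor ε c φ y z
        = √(2 / ε) * gaussianSeries (φ x) z + √(2 / ε) * gaussianSeries (φ y) z
          + (-(2 / ε) * (‖φ x‖ ^ 2 + ‖φ y‖ ^ 2) - (c x x / 2 + c y y / 2) / ε) := by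
      simp only [gaussianFactor]; ring
    simp_rw [e]
    rw [lintegral_exp_linear_gaussianSeries, norm_smul_add_smul_sq,
      Real.mul_self_sqrt (by positivity), Real.sq_sqrt (by positivity), hcφ x y, norm_sub_sq_real]
    congr 2
    field_simp
    ring

/-- For square-integrable features, the Gaussian factor is integrable for the lift: the conditional
law of the latent variable given `(x, y)` is a shifted Gaussian, whose exponential moments are
explicit. -/
theorem integrable_gaussianFactor_latentLift (hε : 0 < ε)
    (hc : Continuous fun p : X × X => c p.1 p.2) (hφ : Continuous φ)
    (hcφ : ∀ x y, c x y = ‖φ x - φ y‖ ^ 2 + c x x / 2 + c y y / 2)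
    {μ ν : Measure X} [IsProbabilityMeasure μ] [IsProbabilityMeasure ν]
    (hμ : Integrable (fun x => ‖φ x‖ ^ 2) μ) (hν : Integrable (fun x => ‖φ x‖ ^ 2) ν)
    (hdμ : Integrable (fun x => c x x) μ) {π : Measure (X × X)} (hπ : π ∈ couplings μ ν) :
    Integrable (fun p => gaussianFactor ε c φ p.1.1 p.2)
      (latentLift gaussianSeq (gaussianFactor ε c φ) (fun x y => c x y / ε) π) := by
  have h := isLatentFactorization_gaussianFactor hε hc hφ hcφ
  have := isProbabilityMeasure_of_mem_couplings hπ
  have n₁ := integrable_comp_fst_of_mem_couplings hπ hμ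
  have n₂ := integrable_comp_snd_of_mem_couplings hπ hν
  have i₁ : Integrable (fun q : X × X => inner ℝ (φ q.1) (φ q.2)) π := by
    have hcont : Continuous fun q : X × X => inner ℝ (φ q.1) (φ q.2) :=
      (hφ.comp continuous_fst).inner (hφ.comp continuous_snd)
    refine (n₁.add n₂).mono' hcont.measurable.aestronglyMeasurable (ae_of_all _ fun q => ?_)
    have h1 := abs_real_inner_le_norm (φ q.1) (φ q.2)
    simp only [Real.norm_eq_abs, Pi.add_apply]
    nlinarith [sq_nonneg (‖φ q.1‖ - ‖φ q.2‖), sq_nonneg ‖φ q.1‖, sq_nonneg ‖φ q.2‖]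
  have hS : Measurable fun p : (X × X) × (ℕ → ℝ) => √(2 / ε) * gaussianSeries (φ p.1.1) p.2 := by
    have h1 : Measurable fun p : X × (ℕ → ℝ) => gaussianSeries (φ p.1) p.2 := by
      refine measurable_gaussianSeries_comp (φ := fun x i => φ x i) fun i => ?_
      exact ((continuous_apply i).comp (lp.uniformContinuous_coe.continuous.comp hφ)).measurable
    exact (h1.comp (by fun_prop : Measurable
      fun p : (X × X) × (ℕ → ℝ) => (p.1.1, p.2))).const_mul _
  have hs2 : √(2 / ε) ^ 2 = 2 / ε := Real.sq_sqrt (by positivity)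
  have hexp0 : ENNReal.ofReal (Real.exp 0) = 1 := by rw [Real.exp_zero, ENNReal.ofReal_one]
  have key : Integrable (fun p : (X × X) × (ℕ → ℝ) => √(2 / ε) * gaussianSeries (φ p.1.1) p.2)
      (latentLift gaussianSeq (gaussianFactor ε c φ) (fun x y => c x y / ε) π) := by
    -- under the shifted law the series has mean `√(2/ε) ⟨φ x, φ x + φ y⟩` and variance `‖φ x‖²`
    refine h.integrable_latentLift_of_exp hS
      (a := fun q => 3 / ε * ‖φ q.1‖ ^ 2 + 2 / ε * inner ℝ (φ q.1) (φ q.2))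
      (b := fun q => -(1 / ε) * ‖φ q.1‖ ^ 2 - 2 / ε * inner ℝ (φ q.1) (φ q.2))
      ((n₁.const_mul _).add (i₁.const_mul _)) ((n₁.const_mul _).sub (i₁.const_mul _))
      (fun q => le_of_eq ?_) fun q => le_of_eq ?_
    · have e (z : ℕ → ℝ) : gaussianFactor ε c φ q.1 z + gaussianFactor ε c φ q.2 z + c q.1 q.2 / ε
          + (√(2 / ε) * gaussianSeries (φ q.1) z
            - (3 / ε * ‖φ q.1‖ ^ 2 + 2 / ε * inner ℝ (φ q.1) (φ q.2)))
          = (2 * √(2 / ε)) * gaussianSeries (φ q.1) z + √(2 / ε) * gaussianSeries (φ q.2) z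
            + (-(1 / ε) * (4 * ‖φ q.1‖ ^ 2 + 4 * inner ℝ (φ q.1) (φ q.2) + ‖φ q.2‖ ^ 2)) := by
        rw [hcφ q.1 q.2, norm_sub_sq_real]
        simp only [gaussianFactor]
        ring
      simp only [e]
      rw [lintegral_exp_linear_gaussianSeries, norm_smul_add_smul_sq, mul_pow,
        show 2 * √(2 / ε) * √(2 / ε) = 2 * √(2 / ε) ^ 2 by ring, hs2]
      exact (congrArg (fun t => ENNReal.ofReal (Real.exp t)) (by ring)).trans hexp0
    · have e (z : ℕ → ℝ) : gaussianFactor ε c φ q.1 z + gaussianFactor ε c φ q.2 z + c q.1 q.2 / ε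
          + (-(√(2 / ε) * gaussianSeries (φ q.1) z)
            - (-(1 / ε) * ‖φ q.1‖ ^ 2 - 2 / ε * inner ℝ (φ q.1) (φ q.2)))
          = 0 * gaussianSeries (φ q.1) z + √(2 / ε) * gaussianSeries (φ q.2) z
            + (-(1 / ε) * ‖φ q.2‖ ^ 2) := by
        rw [hcφ q.1 q.2, norm_sub_sq_real]
        simp only [gaussianFactor]
        ring
      simp only [e]
      rw [lintegral_exp_linear_gaussianSeries, norm_smul_add_smul_sq, hs2]
      exact (congrArg (fun t => ENNReal.ofReal (Real.exp t)) (by ring)).trans hexp0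
  have hfst := h.fst_latentLift (π := π)
  have hlift {f : X × X → ℝ} (hf : Integrable f π) : Integrable (fun p => f p.1)
      (latentLift gaussianSeq (gaussianFactor ε c φ) (fun x y => c x y / ε) π) := by
    rw [← hfst] at hf
    exact hf.comp_measurable measurable_fst
  exact (key.sub (hlift (n₁.const_mul (2 / ε)))).sub
    (hlift (((integrable_comp_fst_of_mem_couplings hπ hdμ).div_const 2).div_const ε))

/-- If the cost is integrable for `μ ⊗ ν`, then the features are square-integrable. -/
theorem integrable_sq_norm_feature
    (hφ : Continuous φ) (hcφ : ∀ x y, c x y = ‖φ x - φ y‖ ^ 2 + c x x / 2 + c y y / 2)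
    {μ ν : Measure X} [IsProbabilityMeasure μ] [IsProbabilityMeasure ν]
    (hdμ : Integrable (fun x => c x x) μ) (hdν : Integrable (fun x => c x x) ν)
    (hint : Integrable (fun p : X × X => c p.1 p.2) (μ.prod ν)) :
    Integrable (fun x => ‖φ x‖ ^ 2) μ := by
  have h1 : Integrable (fun p : X × X => ‖φ p.1 - φ p.2‖ ^ 2) (μ.prod ν) := by
    refine ((hint.sub ((hdμ.comp_fst ν).div_const 2)).sub ((hdν.comp_snd μ).div_const 2)).congr
      (ae_of_all _ fun p => ?_)
    simp only [Pi.sub_apply]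
    rw [hcφ p.1 p.2]
    ring
  obtain ⟨y, hy⟩ := h1.prod_left_ae.exists
  refine ((hy.const_mul 2).add (integrable_const (2 * ‖φ y‖ ^ 2))).mono'
    (hφ.norm.pow 2).measurable.aestronglyMeasurable (ae_of_all _ fun x => ?_)
  simp only [Pi.add_apply]
  rw [Real.norm_of_nonneg (sq_nonneg _)]
  have h2 : ‖φ x‖ ≤ ‖φ x - φ y‖ + ‖φ y‖ := by
    simpa using norm_add_le (φ x - φ y) (φ y)
  nlinarith [norm_nonneg (φ x), norm_nonneg (φ y), norm_nonneg (φ x - φ y),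
    sq_nonneg (‖φ x - φ y‖ - ‖φ y‖)]

/-- The kernel `exp (-c / ε)` is completely positive, written as a Bochner integral. -/
theorem exp_neg_div_eq_integral_gaussianFactor (hε : 0 < ε)
    (hc : Continuous fun p : X × X => c p.1 p.2) (hφ : Continuous φ)
    (hcφ : ∀ x y, c x y = ‖φ x - φ y‖ ^ 2 + c x x / 2 + c y y / 2) (x y : X) :
    Real.exp (-c x y / ε)
      = ∫ z, Real.exp (gaussianFactor ε c φ x z) * Real.exp (gaussianFactor ε c φ y z)
          ∂gaussianSeq := by
  have h := isLatentFactorization_gaussianFactor hε hc hφ hcφ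
  have hm : Measurable fun z => gaussianFactor ε c φ x z + gaussianFactor ε c φ y z :=
    (measurable_gaussianFactor_apply hc hφ x).add (measurable_gaussianFactor_apply hc hφ y)
  simp only [← Real.exp_add]
  rw [integral_eq_lintegral_of_nonneg_ae (ae_of_all _ fun z => (Real.exp_pos _).le)
    (Real.measurable_exp.comp hm).aestronglyMeasurable, h.lintegral_exp,
    ENNReal.toReal_ofReal (Real.exp_pos _).le, neg_div]

theorem memLp_exp_gaussianFactor (hε : 0 < ε)
    (hc : Continuous fun p : X × X => c p.1 p.2) (hφ : Continuous φ)
    (hcφ : ∀ x y, c x y = ‖φ x - φ y‖ ^ 2 + c x x / 2 + c y y / 2) (x : X) :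
    MemLp (fun z => Real.exp (gaussianFactor ε c φ x z)) 2 gaussianSeq := by
  have h := isLatentFactorization_gaussianFactor hε hc hφ hcφ
  have hm : Measurable fun z => Real.exp (gaussianFactor ε c φ x z) :=
    Real.measurable_exp.comp (measurable_gaussianFactor_apply hc hφ x)
  refine (memLp_two_iff_integrable_sq hm.aestronglyMeasurable).2
    ⟨(hm.pow_const 2).aestronglyMeasurable, ?_⟩
  have e : ∫⁻ z, ENNReal.ofReal (Real.exp (gaussianFactor ε c φ x z) ^ 2) ∂gaussianSeq
      = ENNReal.ofReal (Real.exp (-(c x x / ε))) := by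
    rw [← h.lintegral_exp x x]
    exact lintegral_congr fun z => by rw [sq, Real.exp_add]
  rw [hasFiniteIntegral_iff_ofReal (ae_of_all _ fun z => sq_nonneg _), e]
  exact ENNReal.ofReal_lt_top

theorem lseCost_gaussianFactor (hε : 0 < ε)
    (hc : Continuous fun p : X × X => c p.1 p.2) (hφ : Continuous φ)
    (hcφ : ∀ x y, c x y = ‖φ x - φ y‖ ^ 2 + c x x / 2 + c y y / 2) (x y : X) :
    lseCost ε gaussianSeq (fun x z => -ε * gaussianFactor ε c φ x z) x y = c x y := by
  have e : ∫ z, Real.exp (-(-ε * gaussianFactor ε c φ x z + -ε * gaussianFactor ε c φ y z) / ε)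
      ∂gaussianSeq = Real.exp (-c x y / ε) := by
    rw [exp_neg_div_eq_integral_gaussianFactor hε hc hφ hcφ]
    refine integral_congr_ae (ae_of_all _ fun z => ?_)
    simp only
    rw [← Real.exp_add]
    congr 1
    field_simp
    ring
  rw [lseCost, e, Real.log_exp]
  field_simp

/-- If the cost is `μ ⊗ ν`-integrable, then the Gaussian factor is integrable for the lift of every
coupling, at both endpoints. -/
theorem integrable_gaussianFactor_latentLift_of_prod (hε : 0 < ε)
    (hc : Continuous fun p : X × X => c p.1 p.2) (hφ : Continuous φ)
    (hcφ : ∀ x y, c x y = ‖φ x - φ y‖ ^ 2 + c x x / 2 + c y y / 2)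
    {μ ν : Measure X} [IsProbabilityMeasure μ] [IsProbabilityMeasure ν]
    (hdμ : Integrable (fun x => c x x) μ) (hdν : Integrable (fun x => c x x) ν)
    (hint : Integrable (fun p : X × X => c p.1 p.2) (μ.prod ν))
    {π : Measure (X × X)} (hπ : π ∈ couplings μ ν) :
    Integrable (fun p => gaussianFactor ε c φ p.1.1 p.2)
        (latentLift gaussianSeq (gaussianFactor ε c φ) (fun x y => c x y / ε) π) ∧
      Integrable (fun p => gaussianFactor ε c φ p.1.2 p.2)
        (latentLift gaussianSeq (gaussianFactor ε c φ) (fun x y => c x y / ε) π) := by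
  have h := isLatentFactorization_gaussianFactor hε hc hφ hcφ
  have hint' : Integrable (fun p : X × X => c p.1 p.2) (ν.prod μ) := by
    refine hint.swap.congr (ae_of_all _ fun p => ?_)
    simp only [Function.comp, Prod.fst_swap, Prod.snd_swap]
    rw [hcφ p.1 p.2, hcφ p.2 p.1, norm_sub_rev]
    ring
  have n₁ := integrable_sq_norm_feature hφ hcφ hdμ hdν hint
  have n₂ := integrable_sq_norm_feature hφ hcφ hdν hdμ hint'
  refine ⟨integrable_gaussianFactor_latentLift hε hc hφ hcφ n₁ n₂ hdμ hπ, ?_⟩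
  -- the second endpoint is the first one of the exchanged coupling
  have hπp := isProbabilityMeasure_of_mem_couplings hπ
  have j₂ := integrable_gaussianFactor_latentLift hε hc hφ hcφ n₂ n₁ hdν
    (map_swap_mem_couplings hπ)
  rw [h.latentLift_map_swap] at j₂
  exact j₂.comp_measurable
    (by fun_prop : Measurable fun p : (X × X) × (ℕ → ℝ) => ((p.1.2, p.1.1), p.2))

end

theorem mainTheorem2 {X : Type*} [TopologicalSpace X] [PolishSpace X] [MeasurableSpace X]
    [BorelSpace X] (c : X → X → ℝ) (hc : Continuous fun p : X × X => c p.1 p.2)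
    (hneg : NegativeDefiniteCost c) (ε : ℝ) (hε : 0 < ε) :
    (∃ (φ : X → lp (fun _ : ℕ => ℝ) 2) (ρ : X → (ℕ → ℝ) → ℝ),
      Continuous φ ∧
      (∀ x y, c x y = ‖φ x - φ y‖ ^ 2 + c x x / 2 + c y y / 2) ∧
      Measurable (fun p : X × (ℕ → ℝ) => ρ p.1 p.2) ∧
      (∀ x z, 0 < ρ x z) ∧
      (∀ x, ∀ᵐ z ∂gaussianSeq, ∃ S : ℝ,
        Tendsto (fun n => ∑ i ∈ Finset.range n, φ x i * z i) atTop (𝓝 S) ∧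
        ρ x z = Real.exp (√(2 / ε) * S - 2 / ε * ‖φ x‖ ^ 2 - c x x / 2 / ε)) ∧
      (∀ x, MemLp (ρ x) 2 gaussianSeq) ∧
      (∀ x y, Real.exp (-c x y / ε) = ∫ z, ρ x z * ρ y z ∂gaussianSeq) ∧
      (∀ x y, c x y = lseCost ε gaussianSeq (fun x z => -ε * Real.log (ρ x z)) x y) ∧
      (∀ μ ν : AdmissibleMeasure c,
        entropicOT ε c (μ.1 : Measure X) (ν.1 : Measure X) ≤
          ⨅ η : ProbabilityMeasure (ℕ → ℝ),
            upperAdd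
              (upperAdd
                (entropicOT ε (fun x z => -ε * Real.log (ρ x z)) (μ.1 : Measure X) η)
                (entropicOT ε (fun x z => -ε * Real.log (ρ x z)) (ν.1 : Measure X) η))
              ((ENNReal.ofReal ε * InformationTheory.klDiv (η : Measure (ℕ → ℝ)) gaussianSeq :
                ℝ≥0∞) : EReal)) ∧
      (∀ μ ν : AdmissibleMeasure c,
        Integrable (fun p : X × X => c p.1 p.2) ((μ.1 : Measure X).prod (ν.1 : Measure X)) →
        entropicOT ε c (μ.1 : Measure X) (ν.1 : Measure X) =
          ⨅ η : ProbabilityMeasure (ℕ → ℝ),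
            upperAdd
              (upperAdd
                (entropicOT ε (fun x z => -ε * Real.log (ρ x z)) (μ.1 : Measure X) η)
                (entropicOT ε (fun x z => -ε * Real.log (ρ x z)) (ν.1 : Measure X) η))
              ((ENNReal.ofReal ε * InformationTheory.klDiv (η : Measure (ℕ → ℝ)) gaussianSeq :
                ℝ≥0∞) : EReal))) ∧
    Debiasable (fun μ ν : AdmissibleMeasure c =>
      entropicOT ε c (μ.1 : Measure X) (ν.1 : Measure X)) := by
  obtain ⟨φ, hφ, hcφ⟩ := hneg.exists_featureMap hc
  have h := isLatentFactorization_gaussianFactor hε hc hφ hcφ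
  have hupper (μ ν : AdmissibleMeasure c) := by
    have : Nonempty X := (μ.1 : ProbabilityMeasure X).nonempty
    exact le_iInf fun η : ProbabilityMeasure (ℕ → ℝ) =>
      h.entropicOT_le_latent hε μ.2 ν.2 (η : Measure (ℕ → ℝ))
  refine ⟨⟨φ, fun x z => Real.exp (gaussianFactor ε c φ x z), hφ, hcφ,
    Real.measurable_exp.comp h.measurable_factor, fun x z => Real.exp_pos _, fun x => ?_,
    memLp_exp_gaussianFactor hε hc hφ hcφ,
    exp_neg_div_eq_integral_gaussianFactor hε hc hφ hcφ, ?_⟩, h.debiasable hε⟩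
  · filter_upwards [ae_tendsto_gaussianSeries (φ x)] with z hz
    exact ⟨gaussianSeries (φ x) z, hz, by rw [gaussianFactor]⟩
  simp only [Real.log_exp]
  refine ⟨fun x y => (lseCost_gaussianFactor hε hc hφ hcφ x y).symm, hupper,
    fun μ ν hint => le_antisymm (hupper μ ν) ?_⟩
  have : Nonempty X := (μ.1 : ProbabilityMeasure X).nonempty
  have hprod : (μ.1 : Measure X).prod (ν.1 : Measure X) ∈ couplings (μ.1 : Measure X) ν.1 :=
    ⟨by rw [← Measure.fst, Measure.fst_prod], by rw [← Measure.snd, Measure.snd_prod]⟩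
  obtain ⟨d₁, d₂⟩ := integrable_diag_of_mem_couplings hc.measurable (h.cost_half_diag_le hε)
    μ.2 ν.2 hprod hint
  exact h.iInf_latent_le_entropicOT hε μ.2 ν.2 fun π hπ =>
    integrable_gaussianFactor_latentLift_of_prod hε hc hφ hcφ d₁ d₂ hint hπ
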